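/- Let $n\ge 1$. Let $\mathfrak h$ be the space of diagonal matrices in $\mathfrak{gl}(n,\mathbb C)$, let $e_1,\dots,e_n$ be the coordinate functionals, an orthonormal basis of $\mathfrak h^*$ for the bilinear form $\langle\ ,\ \rangle$, let $\Delta^+=\{e_i-e_j\mid 1\le i<j\le n\}$, $\Delta=\Delta^+\cup-\Delta^+$, let $\Pi=\{e_i-e_{i+1}\mid 1\le i<n\}$ be the set of simple roots, and identify the Weyl group $W$ with $\mathfrak S_n$ via $\sigma e_i=e_{\sigma(i)}$. Let $\leqslant$ be the Bruhat ordering of $W$ with respect to the reflections in $\Pi$. *Notation.* Let $\Phi\subseteq\Delta$ be a subsystem with positive system $\Phi^+=\Phi\cap\Delta^+$ and basis $\Pi_\Phi$, and let $\Theta\subseteq\Pi_\Phi$. Put $\mathfrak a_\Theta=\{H\in\mathfrak h\mid \alpha(H)=0\ \forall\alpha\in\Theta\}$. For $\alpha\in\Phi^+$ let $\Phi(\alpha)=\{\beta\in\Phi\mid \beta|_{\mathfrak a_\Theta}\in\mathbb R\,\alpha|_{\mathfrak a_\Theta}\}$, let $\Pi(\alpha)$ be the basis of $\Phi(\alpha)\cap\Phi^+$,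 and let $\sigma_\alpha=w^\alpha w_\Theta$, where $w^\alpha$ and $w_\Theta$ are the longest elements of the Weyl groups generated by the reflections in $\Pi(\alpha)$ and in $\Theta$, respectively. The root $\alpha$ is *useful* if $\sigma_\alpha$ has order two, and *reduced* if $\alpha|_{\mathfrak a_\Theta}\neq0$ and $\alpha\in\Pi(\alpha)-\Theta$. The restrictions to $\mathfrak a_\Theta$ of the useful reduced roots in $\Phi^+$ form a positive system; let ${}^u\Pi_\Theta$ be its simple system. The element $\sigma_\alpha$ depends only on $\gamma=\alpha|_{\mathfrak a_\Theta}$ and is also written $\sigma_\gamma$. Put $S(\Theta)=\{\sigma_\gamma\mid\gamma\in{}^u\Pi_\Theta\}$, and let $W(\Theta)'$ be the group that it generates; $(W(\Theta)',S(\Theta))$ is a Coxeter system. Call $\Theta$ *seminormal* in $\Pi_\Phi$ if there is a $\Psi$ with $\Theta\subseteq\Psi\subseteq\Pi_\Phi$ and ${}^u\Pi_\Theta=\{\alpha|_{\mathfrak a_\Theta}\mid\alpha\in\Psi-\Theta\}$. Now let $\Theta\subsetneq\Pi$. Let $\leqslant_\Theta$ be the Bruhat ordering of $(W(\Theta)',S(\Theta))$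 for $\Phi=\Delta$. Put $W(\Theta)=\{w\in W\mid w\Theta=\Theta\}$, $\Theta_0=\{\beta\in\Theta\mid w\beta=\beta\ \forall w\in W(\Theta)\}$, $\Theta_1=\Theta-\Theta_0$, $\Phi_{\Theta_0}=\{\beta\in\Delta\mid\langle\beta,\theta\rangle=0\ \forall\theta\in\Theta_0\}$ and $\Phi_{\Theta_0}^+=\Phi_{\Theta_0}\cap\Delta^+$. Let $\Pi[\Theta_0]$ be the basis of $\Phi^+_{\Theta_0}$, let $S[\Theta_0]$ be the set of the reflections in $\Pi[\Theta_0]$, let $W[\Theta_0]$ be the group generated by $S[\Theta_0]$, and let $\leqslant_{[\Theta_0]}$ be the Bruhat ordering of $(W[\Theta_0],S[\Theta_0])$. Call $\Theta$ *almost seminormal* if $\Theta_1$ is seminormal in $\Pi[\Theta_0]$. **Statement.** Let $\Theta\subsetneq\Pi$ and let $w\in W$ be such that $w^{-1}\beta\in\Delta^+$ for all $\beta\in\Phi_{\Theta_0}^+$. Then: 1. for all $x,y\in W[\Theta_0]$, $xw\leqslant yw$ if and only if $x\leqslant_{[\Theta_0]}y$; 2. if $\Theta$ is almost seminormal, then $W(\Theta)\subseteq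 W(\Theta)'$, and for all $x,y\in W(\Theta)$, $xw\leqslant yw$ if and only if $x\leqslant_\Theta y$. -/

import Mathlib

namespace TypeA

/-! ### Bruhat orderings of Coxeter systems inside a group -/

section Coxeter

variable {G : Type*} [Group G]

/-- The length of `g` with respect to a set `S` of involutive generators: the least number of
factors in a word in `S` with product `g`.  It is only used for `g` in the subgroup generated
by `S`. -/
noncomputable def wordLength (S : Set G) (g : G) : ℕ :=
  sInf {k | ∃ l : List G, l.length = k ∧ (∀ s ∈ l, s ∈ S) ∧ l.prod = g}

/-- The reflections of the Coxeter system `(⟨S⟩, S)`: the conjugates in `⟨S⟩` of elements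
of `S`. -/
def coxReflections (S : Set G) : Set G :=
  {t | ∃ g ∈ Subgroup.closure S, ∃ s ∈ S, t = g * s * g⁻¹}

/-- One step of the Bruhat ordering: `v = u t` with `t` a reflection and `ℓ(u) < ℓ(v)`. -/
def BruhatStep (S : Set G) (u v : G) : Prop :=
  ∃ t ∈ coxReflections S, v = u * t ∧ wordLength S u < wordLength S v

/-- The Bruhat ordering of the Coxeter system `(⟨S⟩, S)`, as a relation between elements of the
subgroup `⟨S⟩`.  (It is false if one of the two elements is not in `⟨S⟩`.) -/
def BruhatLE (S : Set G) (x y : G) : Prop :=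
  x ∈ Subgroup.closure S ∧ y ∈ Subgroup.closure S ∧ Relation.ReflTransGen (BruhatStep S) x y

/-- `w` is the longest element of the (finite) Coxeter system `(⟨S⟩, S)`. -/
def IsLongest (S : Set G) (w : G) : Prop :=
  w ∈ Subgroup.closure S ∧ ∀ v ∈ Subgroup.closure S, wordLength S v ≤ wordLength S w

end Coxeter

/-- The simple elements of a positive system: those that are not the sum of two elements of
it. -/
def simples {M : Type*} [Add M] (P : Set M) : Set M :=
  {α ∈ P | ¬ ∃ β ∈ P, ∃ γ ∈ P, α = β + γ}

/-! ### The root system of `𝔤𝔩(n, ℂ)`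

The Cartan subalgebra `𝔥` of diagonal matrices is `Fin n → ℂ`, and `𝔥*` is `Fin n → ℂ` as well,
in the coordinates of the orthonormal basis `e 0, …, e (n - 1)`.  Both the pairing of `𝔥*` with
`𝔥` and the bilinear form on `𝔥*` are then the dot product `⬝ᵥ`.  The Weyl group is
`Equiv.Perm (Fin n)`. -/

section Roots

variable {n : ℕ}

/-- The basis vector `e i` of `𝔥*`. -/
def e (i : Fin n) : Fin n → ℂ := Pi.single i 1

/-- The positive roots `e i - e j`, `i < j`. -/
def posRoots (n : ℕ) : Set (Fin n → ℂ) :=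
  {α | ∃ i j : Fin n, i < j ∧ α = e i - e j}

/-- The simple roots. -/
def simpleRoots (n : ℕ) : Set (Fin n → ℂ) := simples (posRoots n)

/-- The action of the Weyl group on `𝔥*`, for which `σ (e i) = e (σ i)`. -/
def act (σ : Equiv.Perm (Fin n)) (v : Fin n → ℂ) : Fin n → ℂ := fun i => v (σ⁻¹ i)

theorem act_e (σ : Equiv.Perm (Fin n)) (i : Fin n) : act σ (e i) = e (σ i) := by
  funext k
  simp only [act, e, Pi.single_apply, Equiv.Perm.inv_eq_iff_eq]

/-- The set of all the reflections `s_α`, `α ∈ B`, as elements of the Weyl group. -/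
def reflections (B : Set (Fin n → ℂ)) : Set (Equiv.Perm (Fin n)) :=
  {s | ∃ α ∈ B, ∀ v, act s v = v - (2 * (v ⬝ᵥ α) / (α ⬝ᵥ α)) • α}

/-- The Bruhat ordering `≤` of the Weyl group `W` of `𝔤𝔩(n, ℂ)`. -/
def weylLE (x y : Equiv.Perm (Fin n)) : Prop := BruhatLE (reflections (simpleRoots n)) x y

/-- The stabilizer `W(Θ) = {w ∈ W | w Θ = Θ}`. -/
def stab (Θ : Set (Fin n → ℂ)) : Set (Equiv.Perm (Fin n)) := {w | act w '' Θ = Θ}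

/-- The subspace `𝔞_Θ` of `𝔥` on which all the elements of `Θ` vanish. -/
def kerSpace (Θ : Set (Fin n → ℂ)) : Set (Fin n → ℂ) := {H | ∀ α ∈ Θ, α ⬝ᵥ H = 0}

/-- The restriction of `α ∈ 𝔥*` to `𝔞_Θ`, as a function on `𝔞_Θ`. -/
def restr (Θ : Set (Fin n → ℂ)) (α : Fin n → ℂ) : kerSpace Θ → ℂ := fun H => α ⬝ᵥ H.1

/-! ### Useful roots

Here `P` is the positive system of a root subsystem `P ∪ -P` of the root system of `𝔤𝔩(n, ℂ)`,
and `Θ` is a set of simple roots for `P`. -/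

/-- The positive part `Δ⁺(α)` of `Δ(α)`, which consists of the roots whose restriction to `𝔞_Θ`
is a real multiple of the restriction of `α`. -/
def lineRoots (P Θ : Set (Fin n → ℂ)) (α : Fin n → ℂ) : Set (Fin n → ℂ) :=
  {β ∈ P | ∃ c : ℝ, restr Θ β = (c : ℂ) • restr Θ α}

/-- `s = σ_α`, where `σ_α = w^α w_Θ` with `w^α` the longest element of the Weyl group of `Δ(α)`
and `w_Θ` the longest element of `W_Θ`. -/
def IsSigma (P Θ : Set (Fin n → ℂ)) (α : Fin n → ℂ) (s : Equiv.Perm (Fin n)) : Prop :=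
  ∃ u v : Equiv.Perm (Fin n), IsLongest (reflections (simples (lineRoots P Θ α))) u ∧
    IsLongest (reflections Θ) v ∧ s = u * v

/-- The root `α` is `Θ`-useful: the order of `σ_α` is two. -/
def IsUseful (P Θ : Set (Fin n → ℂ)) (α : Fin n → ℂ) : Prop :=
  ∃ s, IsSigma P Θ α s ∧ orderOf s = 2

/-- The root `α` is `Θ`-reduced: its restriction to `𝔞_Θ` is not zero, and it is the simple root
for `Δ⁺(α)` which is not in `Θ`. -/
def IsReducedRoot (P Θ : Set (Fin n → ℂ)) (α : Fin n → ℂ) : Prop :=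
  restr Θ α ≠ 0 ∧ α ∈ simples (lineRoots P Θ α) \ Θ

/-- The positive roots that are `Θ`-useful and `Θ`-reduced. -/
def usefulReduced (P Θ : Set (Fin n → ℂ)) : Set (Fin n → ℂ) :=
  {α ∈ P | IsUseful P Θ α ∧ IsReducedRoot P Θ α}

/-- The simple system `ᵘΠ_Θ` of the positive system that the useful reduced positive roots
induce on `𝔞_Θ`. -/
def usefulSimple (P Θ : Set (Fin n → ℂ)) : Set (kerSpace Θ → ℂ) :=
  simples (restr Θ '' usefulReduced P Θ)

/-- The Coxeter generators `S(Θ) = {σ_γ | γ ∈ ᵘΠ_Θ}` of `W(Θ)'`. -/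
def usefulGens (P Θ : Set (Fin n → ℂ)) : Set (Equiv.Perm (Fin n)) :=
  {s | ∃ α ∈ usefulReduced P Θ, restr Θ α ∈ usefulSimple P Θ ∧ IsSigma P Θ α s}

/-- The Bruhat ordering `≤_Θ` of the Coxeter system `(W(Θ)', S(Θ))`, for a set `Θ` of simple
roots of `𝔤𝔩(n, ℂ)`. -/
def thetaLE (Θ : Set (Fin n → ℂ)) (x y : Equiv.Perm (Fin n)) : Prop :=
  BruhatLE (usefulGens (posRoots n) Θ) x y

/-- `Θ` is seminormal, as a set of simple roots for the positive system `P`. -/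
def IsSeminormal (P Θ : Set (Fin n → ℂ)) : Prop :=
  ∃ Ψ, Θ ⊆ Ψ ∧ Ψ ⊆ simples P ∧ usefulSimple P Θ = restr Θ '' (Ψ \ Θ)

/-! ### Almost seminormal sets of simple roots -/

/-- `Θ₀`, the set of the elements of `Θ` that are fixed by `W(Θ)`. -/
def theta0 (Θ : Set (Fin n → ℂ)) : Set (Fin n → ℂ) := {β ∈ Θ | ∀ w ∈ stab Θ, act w β = β}

/-- `Θ₁ = Θ - Θ₀`. -/
def theta1 (Θ : Set (Fin n → ℂ)) : Set (Fin n → ℂ) := Θ \ theta0 Θ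

/-- `Φ⁺_{Θ₀}`, the set of the positive roots in `𝔞*_{Θ₀}`, i.e. orthogonal to `Θ₀`. -/
def phiPos (Θ : Set (Fin n → ℂ)) : Set (Fin n → ℂ) :=
  {β ∈ posRoots n | ∀ θ ∈ theta0 Θ, β ⬝ᵥ θ = 0}

/-- The Coxeter generators `S[Θ₀]`: the reflections in the simple roots `Π[Θ₀]` for
`Φ⁺_{Θ₀}`. -/
def bracketGens (Θ : Set (Fin n → ℂ)) : Set (Equiv.Perm (Fin n)) :=
  reflections (simples (phiPos Θ))

/-- The Weyl group `W[Θ₀]` of `Φ_{Θ₀}`. -/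
def bracketWeyl (Θ : Set (Fin n → ℂ)) : Subgroup (Equiv.Perm (Fin n)) :=
  Subgroup.closure (bracketGens Θ)

/-- The Bruhat ordering of `(W[Θ₀], S[Θ₀])`. -/
def bracketLE (Θ : Set (Fin n → ℂ)) (x y : Equiv.Perm (Fin n)) : Prop :=
  BruhatLE (bracketGens Θ) x y

/-- `Θ` is almost seminormal: `Θ₁` is seminormal as a set of simple roots for `Φ⁺_{Θ₀}`. -/
def IsAlmostSeminormal (Θ : Set (Fin n → ℂ)) : Prop := IsSeminormal (phiPos Θ) (theta1 Θ)

end Roots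

end TypeA

/-!
Both parts rest on the tableau criterion for the Bruhat ordering.  Let `ι` be a finite linear order
with a colouring `c`.  The permutations that preserve the colours form a product of symmetric
groups, which is a Coxeter group for the transpositions of neighbours within a colour class
(`closure_adjSwaps`); its length function counts the inversions within the classes
(`wordLength_adjSwaps`).  Then `x ≤ y` if and only if, for all `p` and `q` of the same colour `k`,
at most as many `a ≤ p` of colour `k` satisfy `x a > q` as satisfy `y a > q`
(`exceed_le_of_bruhatLE`, `bruhatLE_of_exceed_le`).

The roots that are orthogonal to `Θ₀` are the `e i - e j` for `i` and `j` in a set `freeSet Θ` of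
indices.  Hence `W[Θ₀]` is the group of colour-preserving permutations for the colouring with the
class `freeSet Θ` and singletons otherwise, and `W` belongs to the constant colouring.  The
tableau numbers of `x * w` are those of `x` up to terms that do not depend on `x`, because `w⁻¹` is
increasing on `freeSet Θ`; this gives the first part (`weylLE_mul_iff`).

For the second part, `Θ` cuts the indices into intervals, called blocks.  The element `σ_α` exchanges
two blocks if these have the same size, and otherwise it does not have order two
(`IsBlocks.orderOf_eq_two_iff`).  Therefore `W(Θ)` is the group of the size-preserving permutations
of the blocks, and `S(Θ)` consists of the exchanges of consecutive blocks of the same size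
(`IsBlockStart.image_usefulGens`), so that the criterion applies to `≤_Θ`, with the sizes as colours
(`IsBlockStart.thetaLE_iff`).  An exchange of blocks that goes up for `≤_Θ` moves larger values to the
left and so also goes up in `W[Θ₀]`.  Conversely, seminormality of `Θ₁` says that the blocks of a given
size in `freeSet Θ` are contiguous (`IsBlockStart.blockSize_eq_of_between`); then the tableau numbers
of `W[Θ₀]` at the ends of blocks of size `m` are `m` times those of the block permutations
(`IsBlockStart.exceed_eq_mul`).
-/

namespace TypeA

/-! ### Colour-preserving permutations of a finite linear order -/

section Colored

open Equiv

variable {ι κ : Type*} {c : ι → κ}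

theorem perm_apply_inv (x : Perm ι) (i : ι) : x (x⁻¹ i) = i := x.apply_symm_apply i

/-- The permutations that map every colour class to itself. -/
def colorPerms (c : ι → κ) : Subgroup (Perm ι) where
  carrier := {x | ∀ i, c (x i) = c i}
  mul_mem' := fun ha hb i => by rw [Perm.mul_apply, ha, hb]
  one_mem' := fun _ => rfl
  inv_mem' := fun {x} hx i => by rw [← hx (x⁻¹ i), perm_apply_inv]

theorem swap_mem_colorPerms [DecidableEq ι] {i j : ι} (h : c i = c j) : swap i j ∈ colorPerms c := by
  intro k
  rw [swap_apply_def]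
  split_ifs with h1 h2
  · rw [h1, h]
  · rw [h2, h]
  · rfl

variable [LinearOrder ι]

/-- `i < j` are neighbours within one colour class of the colouring `c`. -/
def Consec (c : ι → κ) (i j : ι) : Prop :=
  i < j ∧ c i = c j ∧ ∀ k, i < k → k < j → c k ≠ c i

/-- The transpositions of neighbours within a colour class. -/
def adjSwaps (c : ι → κ) : Set (Perm ι) := {s | ∃ i j, Consec c i j ∧ s = swap i j}

variable [Fintype ι]

theorem exists_consec {i j : ι} (hij : i < j) (hc : c i = c j) : ∃ k ≤ j, Consec c i k := by
  classical
  obtain ⟨k, hk, hmin⟩ := (Finset.univ.filter (fun k => i < k ∧ c i = c k)).exists_minimal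
    ⟨j, by simp [hij, hc]⟩
  simp only [Finset.mem_filter, Finset.mem_univ, true_and] at hk hmin
  have key : ∀ l, i < l → c i = c l → k ≤ l := fun l h1 h2 => by
    by_contra h
    exact h (hmin ⟨h1, h2⟩ (not_le.1 h).le)
  exact ⟨k, key j hij hc, hk.1, hk.2, fun l h1 h2 h3 => not_lt.2 (key l h1 h3.symm) h2⟩

/-- A transitive relation that holds for neighbours within colour classes holds for `i < j` of
the same colour. -/
theorem rel_of_consec {Q : ι → ι → Prop} (htrans : ∀ i j k, Q i j → Q j k → Q i k)
    (h : ∀ i j, Consec c i j → Q i j) {i j : ι} (hij : i < j) (hc : c i = c j) : Q i j := by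
  induction i using WellFoundedGT.induction with
  | ind i ih =>
    obtain ⟨k, hkj, hk⟩ := exists_consec hij hc
    rcases hkj.eq_or_lt with rfl | hlt
    · exact h _ _ hk
    · exact htrans _ _ _ (h _ _ hk) (ih k hk.1 hlt (hk.2.1.symm.trans hc))

theorem eq_one_of_increasing {x : Perm ι} (hx : x ∈ colorPerms c)
    (h : ∀ i j, i < j → c i = c j → x i < x j) : x = 1 := by
  ext i
  induction i using WellFoundedLT.induction with
  | ind i ih =>
    rcases lt_trichotomy (x i) i with h1 | h1 | h1
    · exact absurd (x.injective (ih _ h1)) h1.ne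
    · exact h1
    · exfalso
      have hk : x (x⁻¹ i) = i := perm_apply_inv x _
      have hc : c (x⁻¹ i) = c i := (colorPerms c).inv_mem hx i
      rcases lt_trichotomy (x⁻¹ i) i with h2 | h2 | h2
      · have := ih _ h2
        rw [hk] at this
        exact h2.ne this.symm
      · rw [h2] at hk
        exact h1.ne hk.symm
      · have := h _ _ h2 hc.symm
        rw [hk] at this
        exact lt_asymm h1 this

open scoped Classical in
/-- The inversions of `x` within colour classes. -/
noncomputable def inversions (c : ι → κ) (x : Perm ι) : Finset (ι × ι) :=
  Finset.univ.filter fun p => p.1 < p.2 ∧ c p.1 = c p.2 ∧ x p.2 < x p.1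

theorem mem_inversions {x : Perm ι} {i j : ι} :
    (i, j) ∈ inversions c x ↔ i < j ∧ c i = c j ∧ x j < x i := by
  simp [inversions]

theorem card_inversions_lt {x : Perm ι} {i j : ι} (hij : i < j) (hc : c i = c j)
    (hx : x i < x j) :
    (inversions c x).card < (inversions c (x * swap i j)).card := by
  classical
  have hmem : (i, j) ∈ inversions c (x * swap i j) := by
    simp [mem_inversions, hij, hc, hx]
  rw [← Finset.card_erase_add_one hmem, Nat.lt_succ_iff]
  have hcol : ∀ k, c (swap i j k) = c k := swap_mem_colorPerms hc
  -- conjugate an inversion by the transposition, unless this reverses its order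
  refine Finset.card_le_card_of_injOn
    (fun p => if swap i j p.1 < swap i j p.2 then (swap i j p.1, swap i j p.2) else p) ?_ ?_
  · rintro ⟨a, b⟩ hab
    rw [Finset.mem_coe, mem_inversions] at hab
    obtain ⟨h1, h2, h3⟩ := hab
    simp only [Finset.coe_erase, Set.mem_sdiff, Finset.mem_coe, Set.mem_singleton_iff]
    split_ifs with h
    · refine ⟨mem_inversions.2 ⟨h, by rw [hcol, hcol, h2], by simpa using h3⟩, fun he => ?_⟩
      simp only [Prod.mk.injEq] at he
      have ha : a = j := by rw [← swap_apply_self i j a, he.1, swap_apply_left]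
      have hb : b = i := by rw [← swap_apply_self i j b, he.2, swap_apply_right]
      rw [ha, hb] at h1
      exact lt_asymm h1 hij
    · refine ⟨mem_inversions.2 ⟨h1, h2, ?_⟩, fun he => ?_⟩
      · simp only [Perm.mul_apply, swap_apply_def] at h ⊢
        grind
      · simp only [Prod.mk.injEq] at he
        rw [he.1, he.2] at h3
        exact lt_asymm h3 hx
  · rintro ⟨a, b⟩ hab ⟨a', b'⟩ hab' he
    rw [Finset.mem_coe, mem_inversions] at hab hab'
    have hinv := swap_apply_self i j
    have hinj := (swap i j).injective
    simp only at he
    split_ifs at he with h h' h'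
    · simp only [Prod.mk.injEq] at he ⊢
      exact ⟨hinj he.1, hinj he.2⟩
    · simp only [Prod.mk.injEq] at he
      rw [← he.1, ← he.2, hinv, hinv] at h'
      exact absurd hab.1 h'
    · simp only [Prod.mk.injEq] at he
      rw [he.1, he.2, hinv, hinv] at h
      exact absurd hab'.1 h
    · exact he

theorem card_inversions_mul_swap_le {x : Perm ι} {i j : ι} (h : Consec c i j) :
    (inversions c (x * swap i j)).card ≤ (inversions c x).card + 1 := by
  classical
  have hcol : ∀ k, c (swap i j k) = c k := swap_mem_colorPerms h.2.1
  refine Nat.le_add_of_sub_le ((Finset.pred_card_le_card_erase (a := (i, j))).trans ?_)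
  refine Finset.card_le_card_of_injOn (fun p => (swap i j p.1, swap i j p.2)) ?_ ?_
  · rintro ⟨a, b⟩ hab
    simp only [Finset.coe_erase, Set.mem_sdiff, Finset.mem_coe, Set.mem_singleton_iff] at hab
    obtain ⟨hab, hne⟩ := hab
    obtain ⟨h1, h2, h3⟩ := mem_inversions.1 hab
    refine mem_inversions.2 ⟨?_, by rw [hcol, hcol, h2], h3⟩
    have h4 := h.2.2
    have h5 := h.2.1
    have h6 := h.1
    have h7 := h4 a
    have h8 := h4 b
    simp only [Prod.mk.injEq] at hne
    simp only [swap_apply_def]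
    grind
  · rintro ⟨a, b⟩ _ ⟨a', b'⟩ _ he
    simp only [Prod.mk.injEq] at he ⊢
    exact ⟨(swap i j).injective he.1, (swap i j).injective he.2⟩

theorem card_inversions_prod_le (l : List (Perm ι)) (hl : ∀ s ∈ l, s ∈ adjSwaps c) :
    (inversions c l.prod).card ≤ l.length := by
  induction l using List.reverseRecOn with
  | nil =>
    simp only [List.prod_nil, List.length_nil, Nat.le_zero, Finset.card_eq_zero]
    ext ⟨a, b⟩
    simp only [mem_inversions, Perm.one_apply, Finset.notMem_empty, iff_false]
    exact fun h => lt_asymm h.1 h.2.2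
  | append_singleton l s ih =>
    obtain ⟨i, j, hij, rfl⟩ := hl s (by simp)
    have := card_inversions_mul_swap_le (x := l.prod) hij
    have := ih fun s hs => hl s (by simp [hs])
    simp only [List.prod_append, List.prod_singleton, List.length_append, List.length_singleton]
    lia

theorem exists_word {x : Perm ι} (hx : x ∈ colorPerms c) :
    ∃ l : List (Perm ι), (∀ s ∈ l, s ∈ adjSwaps c) ∧ l.prod = x ∧
      l.length ≤ (inversions c x).card := by
  induction hn : (inversions c x).card using Nat.strong_induction_on generalizing x with
  | _ N ih =>
    by_cases h : ∃ i j, Consec c i j ∧ x j < x i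
    · obtain ⟨i, j, hij, hlt⟩ := h
      have hlt' := card_inversions_lt (x := x * swap i j) hij.1 hij.2.1 (by simpa using hlt)
      rw [mul_assoc, swap_mul_self, mul_one, hn] at hlt'
      obtain ⟨l, h1, h2, h3⟩ :=
        ih _ hlt' ((colorPerms c).mul_mem hx (swap_mem_colorPerms hij.2.1)) rfl
      refine ⟨l ++ [swap i j], fun s hs => ?_, by simp [h2, mul_assoc], by simp; lia⟩
      rcases List.mem_append.1 hs with hs | hs
      · exact h1 s hs
      · exact ⟨i, j, hij, by simpa using hs⟩
    · push Not at h
      have : x = 1 := eq_one_of_increasing hx fun i j hij hc =>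
        rel_of_consec (Q := fun i j => x i < x j) (fun _ _ _ => lt_trans)
          (fun i j hij => (h i j hij).lt_of_ne fun he => hij.1.ne (x.injective he)) hij hc
      exact ⟨[], by simp, by simp [this], by simp⟩

theorem closure_adjSwaps : Subgroup.closure (adjSwaps c) = colorPerms c := by
  refine le_antisymm ((Subgroup.closure_le _).2 ?_) fun x hx => ?_
  · rintro _ ⟨i, j, hij, rfl⟩
    exact swap_mem_colorPerms hij.2.1
  · obtain ⟨l, h1, rfl, -⟩ := exists_word hx
    exact Subgroup.list_prod_mem _ fun s hs => Subgroup.subset_closure (h1 s hs)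

theorem wordLength_adjSwaps {x : Perm ι} (hx : x ∈ colorPerms c) :
    wordLength (adjSwaps c) x = (inversions c x).card := by
  obtain ⟨l, h1, h2, h3⟩ := exists_word hx
  refine le_antisymm (le_trans (Nat.sInf_le ?_) h3) (le_csInf ?_ ?_)
  · exact ⟨l, rfl, h1, h2⟩
  · exact ⟨l.length, l, rfl, h1, h2⟩
  · rintro _ ⟨l', rfl, h4, rfl⟩
    exact card_inversions_prod_le l' h4

theorem coxReflections_adjSwaps {t : Perm ι} :
    t ∈ coxReflections (adjSwaps c) ↔ ∃ i j, i < j ∧ c i = c j ∧ t = swap i j := by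
  rw [coxReflections, closure_adjSwaps]
  constructor
  · rintro ⟨g, hg, _, ⟨i, j, hij, rfl⟩, rfl⟩
    have hc : c (g i) = c (g j) := by rw [hg, hg, hij.2.1]
    rw [← swap_apply_apply]
    rcases lt_or_gt_of_ne (g.injective.ne hij.1.ne) with h | h
    · exact ⟨_, _, h, hc, rfl⟩
    · exact ⟨_, _, h, hc.symm, swap_comm _ _⟩
  · rintro ⟨i, j, hij, hc, rfl⟩
    obtain ⟨k, hkj, hk⟩ := exists_consec hij hc
    refine ⟨swap k j, swap_mem_colorPerms (hk.2.1.symm.trans hc), _, ⟨i, k, hk, rfl⟩, ?_⟩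
    rw [← swap_apply_apply, swap_apply_left, swap_apply_of_ne_of_ne hk.1.ne hij.ne]

theorem bruhatStep_adjSwaps {x y : Perm ι} (hx : x ∈ colorPerms c) :
    BruhatStep (adjSwaps c) x y ↔ ∃ i j, i < j ∧ c i = c j ∧ x i < x j ∧ y = x * swap i j := by
  constructor
  · rintro ⟨t, ht, rfl, hlt⟩
    obtain ⟨i, j, hij, hc, rfl⟩ := coxReflections_adjSwaps.1 ht
    refine ⟨i, j, hij, hc, ?_, rfl⟩
    rw [wordLength_adjSwaps hx,
      wordLength_adjSwaps ((colorPerms c).mul_mem hx (swap_mem_colorPerms hc))] at hlt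
    by_contra h
    have hlt' : x j < x i := (not_lt.1 h).lt_of_ne (x.injective.ne hij.ne')
    have := card_inversions_lt (x := x * swap i j) hij hc (by simpa using hlt')
    rw [mul_assoc, swap_mul_self, mul_one] at this
    exact lt_asymm hlt this
  · rintro ⟨i, j, hij, hc, hlt, rfl⟩
    refine ⟨_, coxReflections_adjSwaps.2 ⟨i, j, hij, hc, rfl⟩, rfl, ?_⟩
    rw [wordLength_adjSwaps hx,
      wordLength_adjSwaps ((colorPerms c).mul_mem hx (swap_mem_colorPerms hc))]
    exact card_inversions_lt hij hc hlt

theorem isLongest_adjSwaps {x : Perm ι} (h : IsLongest (adjSwaps c) x) :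
    x ∈ colorPerms c ∧ ∀ i j, i < j → c i = c j → x j < x i := by
  obtain ⟨hx, hmax⟩ := h
  rw [closure_adjSwaps] at hx hmax
  refine ⟨hx, fun i j hij hc => ?_⟩
  by_contra hle
  have hlt : x i < x j := (not_lt.1 hle).lt_of_ne (x.injective.ne hij.ne)
  have hmem := (colorPerms c).mul_mem hx (swap_mem_colorPerms hc)
  have := hmax _ hmem
  rw [wordLength_adjSwaps hx, wordLength_adjSwaps hmem] at this
  exact not_lt.2 this (card_inversions_lt hij hc hlt)

theorem exists_isLongest {G : Type*} [Group G] [Finite G] (S : Set G) : ∃ x, IsLongest S x := by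
  obtain ⟨x, hx, h⟩ := Set.exists_max_image (Subgroup.closure S : Set G) (wordLength S)
    (Set.toFinite _) ⟨1, Subgroup.one_mem _⟩
  exact ⟨x, hx, h⟩

/-! ### The tableau criterion for the Bruhat ordering -/

open scoped Classical in
/-- The number of the `a ≤ p` of colour `k` with `x a > q`. -/
noncomputable def exceed (c : ι → κ) (x : Perm ι) (k : κ) (p q : ι) : ℕ :=
  (Finset.univ.filter fun a => a ≤ p ∧ c a = k ∧ q < x a).card

/-- Multiplication by an involution `t` that only moves larger values to the left increases
`exceed`. -/
theorem exceed_le_mul {x t : Perm ι} (ht : t ∈ colorPerms c) (htt : t * t = 1)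
    (h : ∀ a, a < t a → x a < x (t a)) (k : κ) (p q : ι) :
    exceed c x k p q ≤ exceed c (x * t) k p q := by
  classical
  have htt' : ∀ a, t (t a) = a := fun a => by rw [← Perm.mul_apply, htt, Perm.one_apply]
  refine Finset.card_le_card_of_injOn (fun a => if t a ≤ p then t a else a) ?_ ?_
  · intro a ha
    simp only [Finset.coe_filter, Finset.mem_univ, true_and, Set.mem_ofPred_eq] at ha ⊢
    obtain ⟨h1, h2, h3⟩ := ha
    split_ifs with h4
    · exact ⟨h4, by rw [ht, h2], by rwa [Perm.mul_apply, htt']⟩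
    · exact ⟨h1, h2, h3.trans (h a (h1.trans_lt (not_le.1 h4)))⟩
  · intro a ha b hb hab
    simp only [Finset.coe_filter, Finset.mem_univ, true_and, Set.mem_ofPred_eq] at ha hb hab
    split_ifs at hab with h1 h2 h2
    · exact t.injective hab
    · rw [← hab, htt'] at h2
      exact absurd ha.1 h2
    · rw [hab, htt'] at h1
      exact absurd hb.1 h1
    · exact hab

theorem exceed_le_of_bruhatLE {x y : Perm ι} (h : BruhatLE (adjSwaps c) x y) (k : κ) (p q : ι) :
    exceed c x k p q ≤ exceed c y k p q := by
  obtain ⟨hx, -, h⟩ := h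
  rw [closure_adjSwaps] at hx
  suffices H : y ∈ colorPerms c ∧ exceed c x k p q ≤ exceed c y k p q from H.2
  induction h with
  | refl => exact ⟨hx, le_rfl⟩
  | tail _ hstep ih =>
    obtain ⟨i, j, hij, hc, hlt, rfl⟩ := (bruhatStep_adjSwaps ih.1).1 hstep
    refine ⟨(colorPerms c).mul_mem ih.1 (swap_mem_colorPerms hc), ih.2.trans
      (exceed_le_mul (swap_mem_colorPerms hc) (swap_mul_self _ _) (fun a ha => ?_) k p q)⟩
    rw [swap_apply_def] at ha ⊢
    grind

open scoped Classical in
theorem card_filter_le_split (P : ι → Prop) {i p : ι} (hip : i ≤ p) :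
    (Finset.univ.filter fun a => a ≤ p ∧ P a).card =
      (Finset.univ.filter fun a => a < i ∧ P a).card + (if P i then 1 else 0) +
        (Finset.univ.filter fun a => i < a ∧ a ≤ p ∧ P a).card := by
  have h1 : (Finset.univ.filter fun a => a ≤ p ∧ P a) =
      ((Finset.univ.filter fun a => a < i ∧ P a) ∪ (Finset.univ.filter fun a => a = i ∧ P a)) ∪
        (Finset.univ.filter fun a => i < a ∧ a ≤ p ∧ P a) := by
    ext a
    simp only [Finset.mem_filter, Finset.mem_univ, true_and, Finset.mem_union]
    grind
  rw [h1, Finset.card_union_of_disjoint, Finset.card_union_of_disjoint]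
  · congr 2
    split_ifs with h
    · rw [Finset.card_eq_one]
      exact ⟨i, by ext a; simp only [Finset.mem_filter, Finset.mem_univ, true_and,
        Finset.mem_singleton]; grind⟩
    · rw [Finset.card_eq_zero]
      ext a
      simp only [Finset.mem_filter, Finset.mem_univ, true_and, Finset.notMem_empty]
      grind
  · rw [Finset.disjoint_left]
    intro a
    simp only [Finset.mem_filter, Finset.mem_univ, true_and]
    grind
  · rw [Finset.disjoint_left]
    intro a
    simp only [Finset.mem_filter, Finset.mem_univ, true_and, Finset.mem_union]
    grind

/-- One step of the tableau criterion. -/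
theorem exists_step_of_exceed_le {x y : Perm ι} (hx : x ∈ colorPerms c) (hy : y ∈ colorPerms c)
    (h : ∀ p q, c p = c q → exceed c x (c p) p q ≤ exceed c y (c p) p q) (hne : x ≠ y) :
    ∃ i j, i < j ∧ c i = c j ∧ x i < x j ∧
      ∀ p q, c p = c q → exceed c (x * swap i j) (c p) p q ≤ exceed c y (c p) p q := by
  classical
  -- `i` is the first place where `x` and `y` differ
  obtain ⟨i, hi, hbefore⟩ : ∃ i, x i ≠ y i ∧ ∀ a, a < i → x a = y a := by
    obtain ⟨i₀, hi₀⟩ := not_forall.1 fun h => hne (Equiv.ext h)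
    obtain ⟨i, hi, hmin⟩ := (Finset.univ.filter fun a => x a ≠ y a).exists_minimal
      ⟨i₀, by simpa using hi₀⟩
    simp only [Finset.mem_filter, Finset.mem_univ, true_and] at hi hmin
    refine ⟨i, hi, fun a ha => ?_⟩
    by_contra hne
    exact absurd ha (not_lt.2 (hmin hne ha.le))
  have hsplit : ∀ (z : Perm ι) k p q, i ≤ p → exceed c z k p q =
      (Finset.univ.filter fun a => a < i ∧ c a = k ∧ q < z a).card +
        (if c i = k ∧ q < z i then 1 else 0) +
        (Finset.univ.filter fun a => i < a ∧ a ≤ p ∧ c a = k ∧ q < z a).card :=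
    fun z k p q hp => by
      unfold exceed
      convert card_filter_le_split (fun a => c a = k ∧ q < z a) hp
  have hbeforeset : ∀ k q, (Finset.univ.filter fun a => a < i ∧ c a = k ∧ q < x a) =
      (Finset.univ.filter fun a => a < i ∧ c a = k ∧ q < y a) := by
    intro k q
    ext a
    simp only [Finset.mem_filter, Finset.mem_univ, true_and]
    refine and_congr_right fun ha => ?_
    rw [hbefore a ha]
  have hempty : ∀ z : Perm ι, ∀ q, (Finset.univ.filter fun a => i < a ∧ a ≤ i ∧ c a = c i ∧
      q < z a) = ∅ := by
    intro z q
    ext a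
    simp only [Finset.mem_filter, Finset.mem_univ, true_and, Finset.notMem_empty, iff_false]
    exact fun h => not_lt.2 h.2.1 h.1
  have hlt : x i < y i := by
    by_contra hle
    have hlt : y i < x i := (not_lt.1 hle).lt_of_ne hi.symm
    have := h i (y i) (hy i).symm
    rw [hsplit x _ _ _ le_rfl, hsplit y _ _ _ le_rfl, hbeforeset, hempty, hempty] at this
    simp [hlt] at this
  -- `j` is the first place after `i` with `x i < x j ≤ y i`
  obtain ⟨j, ⟨hij, hcj, hxj, hxj'⟩, hmin⟩ : ∃ j, (i < j ∧ c i = c j ∧ x i < x j ∧ x j ≤ y i) ∧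
      ∀ a, i < a → a < j → c i = c a → x i < x a → y i < x a := by
    have hk : x (x⁻¹ (y i)) = y i := perm_apply_inv x _
    have hck : c (x⁻¹ (y i)) = c i := ((colorPerms c).inv_mem hx _).trans (hy i)
    obtain ⟨j, hj, hmin⟩ := (Finset.univ.filter fun j => i < j ∧ c i = c j ∧ x i < x j ∧
      x j ≤ y i).exists_minimal ⟨x⁻¹ (y i), by
        simp only [Finset.mem_filter, Finset.mem_univ, true_and, hk, hck, hlt, le_refl, and_true]
        rcases lt_trichotomy (x⁻¹ (y i)) i with h1 | h1 | h1
        · have := hbefore _ h1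
          rw [hk] at this
          exact absurd (y.injective this) h1.ne'
        · rw [h1] at hk
          exact absurd hk hi
        · exact h1⟩
    simp only [Finset.mem_filter, Finset.mem_univ, true_and] at hj hmin
    refine ⟨j, hj, fun a h1 h2 h3 h4 => ?_⟩
    by_contra h5
    exact absurd h2 (not_lt.2 (hmin ⟨h1, h3, h4, not_lt.1 h5⟩ h2.le))
  refine ⟨i, j, hij, hcj, hxj, fun p q hpq => ?_⟩
  by_cases hcase : c p = c i ∧ i ≤ p ∧ p < j ∧ x i ≤ q ∧ q < x j
  · obtain ⟨hcp, hip, hpj, hq, hq'⟩ := hcase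
    have h0 := h p (y i) (hcp.trans (hy i).symm)
    rw [hsplit x _ _ _ hip, hsplit y _ _ _ hip, hbeforeset] at h0
    rw [hsplit _ _ _ _ hip, hsplit y _ _ _ hip]
    have hi1 : ¬ (c i = c p ∧ y i < x i) := fun h => lt_asymm h.2 hlt
    have hi2 : ¬ (c i = c p ∧ y i < y i) := fun h => lt_irrefl _ h.2
    rw [if_neg hi1, if_neg hi2] at h0
    have hi3 : c i = c p ∧ q < (x * swap i j) i := ⟨hcp.symm, by simpa using hq'⟩
    have hi4 : c i = c p ∧ q < y i := ⟨hcp.symm, hq'.trans_le hxj'⟩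
    rw [if_pos hi3, if_pos hi4]
    have e1 : (Finset.univ.filter fun a => a < i ∧ c a = c p ∧ q < (x * swap i j) a) =
        (Finset.univ.filter fun a => a < i ∧ c a = c p ∧ q < y a) := by
      ext a
      simp only [Finset.mem_filter, Finset.mem_univ, true_and]
      refine and_congr_right fun ha => ?_
      rw [Perm.mul_apply, swap_apply_of_ne_of_ne ha.ne (ha.trans hij).ne, hbefore a ha]
    have e2 : (Finset.univ.filter fun a => i < a ∧ a ≤ p ∧ c a = c p ∧ q < (x * swap i j) a) ⊆
        (Finset.univ.filter fun a => i < a ∧ a ≤ p ∧ c a = c p ∧ y i < x a) := by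
      intro a
      simp only [Finset.mem_filter, Finset.mem_univ, true_and]
      rintro ⟨h1, h2, h3, h4⟩
      have h5 : a < j := h2.trans_lt hpj
      rw [Perm.mul_apply, swap_apply_of_ne_of_ne h1.ne' h5.ne] at h4
      exact ⟨h1, h2, h3, hmin a h1 h5 (hcp.symm.trans h3.symm) (hq.trans_lt h4)⟩
    have e3 : (Finset.univ.filter fun a => i < a ∧ a ≤ p ∧ c a = c p ∧ y i < y a) ⊆
        (Finset.univ.filter fun a => i < a ∧ a ≤ p ∧ c a = c p ∧ q < y a) := by
      intro a
      simp only [Finset.mem_filter, Finset.mem_univ, true_and]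
      exact fun ⟨h1, h2, h3, h4⟩ => ⟨h1, h2, h3, (hq'.trans_le hxj').trans h4⟩
    have := Finset.card_le_card e2
    have := Finset.card_le_card e3
    rw [e1]
    lia
  · refine le_trans ?_ (h p q hpq)
    have hcol : ∀ k, c (swap i j k) = c k := swap_mem_colorPerms hcj
    by_cases hpj : j ≤ p
    · refine Finset.card_le_card_of_injOn (swap i j) ?_ (swap i j).injective.injOn
      intro a
      simp only [Finset.coe_filter, Finset.mem_univ, true_and, Set.mem_ofPred_eq]
      rintro ⟨h1, h2, h3⟩
      refine ⟨?_, by rw [hcol, h2], h3⟩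
      rw [swap_apply_def]
      split_ifs
      exacts [hpj, hij.le.trans hpj, h1]
    · refine Finset.card_le_card fun a => ?_
      simp only [Finset.mem_filter, Finset.mem_univ, true_and]
      rintro ⟨h1, h2, h3⟩
      refine ⟨h1, h2, ?_⟩
      have haj : a ≠ j := fun he => hpj (he ▸ h1)
      rcases eq_or_ne a i with rfl | hai
      · rw [Perm.mul_apply, swap_apply_left] at h3
        by_contra hle
        exact hcase ⟨h2.symm, h1, not_le.1 hpj, not_lt.1 hle, h3⟩
      · rwa [Perm.mul_apply, swap_apply_of_ne_of_ne hai haj] at h3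

/-- The tableau criterion. -/
theorem bruhatLE_of_exceed_le {x y : Perm ι} (hx : x ∈ colorPerms c) (hy : y ∈ colorPerms c)
    (h : ∀ p q, c p = c q → exceed c x (c p) p q ≤ exceed c y (c p) p q) :
    BruhatLE (adjSwaps c) x y := by
  refine ⟨by rwa [closure_adjSwaps], by rwa [closure_adjSwaps], ?_⟩
  induction hn : Fintype.card (ι × ι) - (inversions c x).card using Nat.strong_induction_on
    generalizing x with
  | _ N ih =>
    by_cases hne : x = y
    · rw [hne]
    · obtain ⟨i, j, hij, hc, hlt, hle⟩ := exists_step_of_exceed_le hx hy h hne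
      refine Relation.ReflTransGen.head
        ((bruhatStep_adjSwaps hx).2 ⟨i, j, hij, hc, hlt, rfl⟩)
        (ih _ ?_ ((colorPerms c).mul_mem hx (swap_mem_colorPerms hc)) hle rfl)
      have h1 := card_inversions_lt hij hc hlt
      have h2 : (inversions c (x * swap i j)).card ≤ Fintype.card (ι × ι) := Finset.card_le_univ _
      lia

end Colored

/-! ### Bruhat orderings and injective homomorphisms -/

section Transport

variable {G K : Type*} [Group G] [Group K] {f : G →* K} {S : Set G}

theorem wordLength_image (hf : Function.Injective f) (g : G) :
    wordLength (f '' S) (f g) = wordLength S g := by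
  unfold wordLength
  congr 1
  ext k
  constructor
  · rintro ⟨l, rfl, hl, hp⟩
    have : ∃ l' : List G, (∀ s ∈ l', s ∈ S) ∧ l'.map f = l := by
      clear hp
      induction l with
      | nil => exact ⟨[], by simp⟩
      | cons a l ih =>
        obtain ⟨l', h1, rfl⟩ := ih fun s hs => hl s (by simp [hs])
        obtain ⟨b, hb, rfl⟩ := hl a (by simp)
        exact ⟨b :: l', by simpa using ⟨hb, h1⟩, by simp⟩
    obtain ⟨l', h1, rfl⟩ := this
    exact ⟨l', by simp, h1, hf (by rw [map_list_prod, hp])⟩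
  · rintro ⟨l, rfl, hl, rfl⟩
    refine ⟨l.map f, by simp, ?_, by rw [map_list_prod]⟩
    intro s hs
    obtain ⟨a, ha, rfl⟩ := List.mem_map.1 hs
    exact ⟨a, hl a ha, rfl⟩

theorem coxReflections_image : coxReflections (f '' S) = f '' coxReflections S := by
  ext t
  simp only [coxReflections, Set.mem_ofPred_eq, Set.mem_image, ← MonoidHom.map_closure,
    Subgroup.mem_map]
  constructor
  · rintro ⟨_, ⟨g, hg, rfl⟩, _, ⟨s, hs, rfl⟩, rfl⟩
    exact ⟨_, ⟨g, hg, s, hs, rfl⟩, by simp⟩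
  · rintro ⟨_, ⟨g, hg, s, hs, rfl⟩, rfl⟩
    exact ⟨_, ⟨g, hg, rfl⟩, _, ⟨s, hs, rfl⟩, by simp⟩

theorem bruhatStep_image (hf : Function.Injective f) {u : G} {v : K} :
    BruhatStep (f '' S) (f u) v ↔ ∃ v', BruhatStep S u v' ∧ f v' = v := by
  unfold BruhatStep
  rw [coxReflections_image]
  constructor
  · rintro ⟨_, ⟨t, ht, rfl⟩, rfl, hlt⟩
    rw [← map_mul, wordLength_image hf, wordLength_image hf] at hlt
    exact ⟨u * t, ⟨t, ht, rfl, hlt⟩, map_mul _ _ _⟩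
  · rintro ⟨_, ⟨t, ht, rfl, hlt⟩, rfl⟩
    refine ⟨_, ⟨t, ht, rfl⟩, map_mul _ _ _, ?_⟩
    rwa [wordLength_image hf, wordLength_image hf]

/-- An injective homomorphism preserves and reflects Bruhat orderings. -/
theorem bruhatLE_image (hf : Function.Injective f) {x y : G} :
    BruhatLE (f '' S) (f x) (f y) ↔ BruhatLE S x y := by
  unfold BruhatLE
  rw [← MonoidHom.map_closure, Subgroup.mem_map_iff_mem hf, Subgroup.mem_map_iff_mem hf]
  refine and_congr_right fun _ => and_congr_right fun _ => ⟨fun h => ?_, fun h => ?_⟩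
  · obtain ⟨y', hy, he⟩ : ∃ y', Relation.ReflTransGen (BruhatStep S) x y' ∧ f y' = f y := by
      generalize f y = z at h
      induction h with
      | refl => exact ⟨x, .refl, rfl⟩
      | tail _ hs ih =>
        obtain ⟨v, hv, rfl⟩ := ih
        obtain ⟨v', hv', rfl⟩ := (bruhatStep_image hf).1 hs
        exact ⟨v', hv.tail hv', rfl⟩
    rwa [← hf he]
  · exact h.lift f fun a b hab => (bruhatStep_image hf).2 ⟨b, hab, rfl⟩

end Transport

/-! ### Sets of roots and their reflections -/

section RootSets

open Equiv

variable {n : ℕ}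

theorem e_apply (i k : Fin n) : e i k = if k = i then 1 else 0 := by
  simp [e, Pi.single_apply]

theorem e_injective : Function.Injective (e : Fin n → Fin n → ℂ) := by
  intro i j h
  have := congrFun h i
  rw [e_apply, e_apply, if_pos rfl] at this
  by_contra hne
  rw [if_neg hne] at this
  exact one_ne_zero this

theorem root_injective {i j k l : Fin n} (hij : i ≠ j) (h : e i - e j = e k - e l) :
    i = k ∧ j = l := by
  have h1 := congrFun h i
  have h2 := congrFun h j
  simp only [Pi.sub_apply, e_apply, if_true, if_neg hij, if_neg hij.symm] at h1 h2
  constructor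
  · by_contra hne
    rw [if_neg hne] at h1
    split_ifs at h1 <;> norm_num at h1
  · by_contra hne
    rw [if_neg hne] at h2
    split_ifs at h2 <;> norm_num at h2

theorem eq_of_e_add_e {a b i d : Fin n} (h : e a + e b = e i + e d) :
    (a = i ∧ b = d) ∨ (a = d ∧ b = i) := by
  by_cases hai : a = i
  · rw [hai] at h
    exact Or.inl ⟨hai, e_injective (add_left_cancel h)⟩
  · refine Or.inr ?_
    obtain ⟨h1, h2⟩ := root_injective hai (sub_eq_sub_iff_add_eq_add.2
      (h.trans (add_comm _ _)) : e a - e i = e d - e b)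
    exact ⟨h1, h2.symm⟩

theorem root_eq_add {i j k l k' l' : Fin n} (hij : i ≠ j) (hkl : k ≠ l) (hkl' : k' ≠ l')
    (h : e i - e j = (e k - e l) + (e k' - e l')) :
    (i = k ∧ l = k' ∧ l' = j) ∨ (i = k' ∧ l' = k ∧ l = j) := by
  have hi : i = k ∨ i = k' := by
    have := congrFun h i
    simp only [Pi.sub_apply, Pi.add_apply, e_apply, if_true, if_neg hij] at this
    by_contra! hne
    rw [if_neg hne.1, if_neg hne.2] at this
    split_ifs at this <;> norm_num at this
  rcases hi with rfl | rfl
  · rcases eq_of_e_add_e (a := l) (b := l') (i := j) (d := k') (by linear_combination h)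
      with h1 | h1
    · exact absurd h1.2.symm hkl'
    · exact Or.inl ⟨rfl, h1⟩
  · rcases eq_of_e_add_e (a := l') (b := l) (i := j) (d := k) (by linear_combination h)
      with h1 | h1
    · exact absurd h1.2.symm hkl
    · exact Or.inr ⟨rfl, h1⟩

/-- The set of the vectors `e i - e j` for the pairs `(i, j)` in the relation `R`. -/
def rootsOf (R : Fin n → Fin n → Prop) : Set (Fin n → ℂ) := {α | ∃ i j, R i j ∧ α = e i - e j}

theorem mem_rootsOf {R : Fin n → Fin n → Prop} {i j : Fin n} (hij : i ≠ j) :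
    e i - e j ∈ rootsOf R ↔ R i j := by
  constructor
  · rintro ⟨k, l, h, he⟩
    obtain ⟨rfl, rfl⟩ := root_injective hij he
    exact h
  · exact fun h => ⟨i, j, h, rfl⟩

theorem simples_rootsOf {R : Fin n → Fin n → Prop} (hR : ∀ i j, R i j → i ≠ j) :
    simples (rootsOf R) = rootsOf fun i j => R i j ∧ ¬ ∃ k, R i k ∧ R k j := by
  ext α
  constructor
  · rintro ⟨⟨i, j, hij, rfl⟩, h⟩
    refine ⟨i, j, ⟨hij, fun ⟨k, h1, h2⟩ => h ?_⟩, rfl⟩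
    exact ⟨_, ⟨i, k, h1, rfl⟩, _, ⟨k, j, h2, rfl⟩, by abel⟩
  · rintro ⟨i, j, ⟨hij, h⟩, rfl⟩
    refine ⟨⟨i, j, hij, rfl⟩, ?_⟩
    rintro ⟨_, ⟨k, l, hkl, rfl⟩, _, ⟨k', l', hkl', rfl⟩, he⟩
    rcases root_eq_add (hR _ _ hij) (hR _ _ hkl) (hR _ _ hkl') he with
      ⟨rfl, rfl, rfl⟩ | ⟨rfl, rfl, rfl⟩
    · exact h ⟨_, hkl, hkl'⟩
    · exact h ⟨_, hkl', hkl⟩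

theorem simples_rootsOf_color {κ : Type*} (c : Fin n → κ) :
    simples (rootsOf fun i j => i < j ∧ c i = c j) = rootsOf (Consec c) := by
  rw [simples_rootsOf fun i j h => h.1.ne]
  congr 1
  ext i j
  constructor
  · rintro ⟨⟨h1, h2⟩, h3⟩
    exact ⟨h1, h2, fun k h4 h5 h6 => h3 ⟨k, ⟨h4, h6.symm⟩, h5, h6.trans h2⟩⟩
  · rintro ⟨h1, h2, h3⟩
    exact ⟨⟨h1, h2⟩, fun ⟨k, h4, h5⟩ => h3 k h4.1 h5.1 h4.2.symm⟩

theorem sub_dotProduct_e (i j : Fin n) (H : Fin n → ℂ) : (e i - e j) ⬝ᵥ H = H i - H j := by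
  simp [e, sub_dotProduct]

theorem act_sub (σ : Perm (Fin n)) (v w : Fin n → ℂ) : act σ (v - w) = act σ v - act σ w := rfl

theorem act_root (σ : Perm (Fin n)) (i j : Fin n) : act σ (e i - e j) = e (σ i) - e (σ j) := by
  rw [act_sub, act_e, act_e]

theorem act_injective : Function.Injective (act : Perm (Fin n) → (Fin n → ℂ) → Fin n → ℂ) := by
  intro s t h
  ext i
  have := congrFun h (e i)
  rw [act_e, act_e] at this
  rw [e_injective this]

theorem act_swap {i j : Fin n} (hij : i ≠ j) (v : Fin n → ℂ) :
    act (swap i j) v =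
      v - (2 * (v ⬝ᵥ (e i - e j)) / ((e i - e j) ⬝ᵥ (e i - e j))) • (e i - e j) := by
  have h2 : (e i - e j) ⬝ᵥ (e i - e j) = (2 : ℂ) := by
    rw [sub_dotProduct_e]
    simp only [Pi.sub_apply, e_apply, if_true, if_neg hij, if_neg hij.symm]
    norm_num
  rw [h2, dotProduct_comm, sub_dotProduct_e]
  funext k
  simp only [act, swap_inv, Pi.sub_apply, Pi.smul_apply, e_apply, smul_eq_mul, swap_apply_def]
  by_cases h1 : k = i
  · simp [h1, hij]
  · by_cases h3 : k = j
    · simp [h3, hij.symm]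
    · simp [h1, h3]

theorem reflections_rootsOf {R : Fin n → Fin n → Prop} (hR : ∀ i j, R i j → i ≠ j) :
    reflections (rootsOf R) = {s | ∃ i j, R i j ∧ s = swap i j} := by
  ext s
  constructor
  · rintro ⟨_, ⟨i, j, hij, rfl⟩, h⟩
    refine ⟨i, j, hij, act_injective ?_⟩
    funext v
    rw [h, act_swap (hR _ _ hij)]
  · rintro ⟨i, j, hij, rfl⟩
    exact ⟨_, ⟨i, j, hij, rfl⟩, act_swap (hR _ _ hij)⟩

theorem reflections_consec {κ : Type*} (c : Fin n → κ) :
    reflections (rootsOf (Consec c)) = adjSwaps c :=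
  reflections_rootsOf fun _ _ h => h.1.ne

end RootSets

/-! ### Useful roots and block exchanges -/

section Blocks

open Equiv

variable {n : ℕ}

/-- The number of the elements of colour `a`. -/
noncomputable def classSize (c : Fin n → Fin n) (a : Fin n) : ℕ :=
  (Finset.univ.filter fun k => c k = a).card

theorem classSize_le {c : Fin n → Fin n} {a b : Fin n} (s : Perm (Fin n))
    (h : ∀ k, c k = a → c (s k) = b) : classSize c a ≤ classSize c b :=
  Finset.card_le_card_of_injOn s (fun k hk => by simpa using h k (by simpa using hk))
    s.injective.injOn

theorem classSize_lt {c : Fin n → Fin n} {a b m : Fin n} (s : Perm (Fin n)) (hm : c m = b)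
    (h : ∀ k, c k = a → c (s k) = b ∧ s k ≠ m) : classSize c a < classSize c b := by
  have : m ∈ Finset.univ.filter fun k => c k = b := by simpa using hm
  unfold classSize
  rw [← Finset.card_erase_add_one this, Nat.lt_succ_iff]
  refine Finset.card_le_card_of_injOn s (fun k hk => ?_) s.injective.injOn
  simpa [and_comm] using h k (by simpa using hk)

/-- `s` exchanges the colour classes `a` and `b` in an order-preserving way and fixes all the
other points. -/
structure SwapsClasses (c : Fin n → Fin n) (a b : Fin n) (s : Perm (Fin n)) : Prop where
  left : ∀ k, c k = a → c (s k) = b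
  right : ∀ k, c k = b → c (s k) = a
  other : ∀ k, c k ≠ a → c k ≠ b → s k = k
  incr : ∀ k l, c k = c l → k < l → s k < s l
  sq : s * s = 1

/-- The set `P` of positive roots is that of the pairs in `E`, and `Θ` consists of the simple roots
that join neighbours in the colour classes of `c`.  On `E` these classes are intervals in `E`, and
outside `E` they are singletons. -/
structure IsBlocks (E : Set (Fin n)) (c : Fin n → Fin n) (P Θ : Set (Fin n → ℂ)) : Prop where
  mono : MonotoneOn c E
  outside : ∀ i j, c i = c j → i = j ∨ (i ∈ E ∧ j ∈ E)
  pos_eq : P = rootsOf fun i j => i < j ∧ i ∈ E ∧ j ∈ E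
  theta_eq : Θ = rootsOf (Consec c)

/-- The colouring for which the class `c j` is merged with the class `c i`. -/
def merge (c : Fin n → Fin n) (i j k : Fin n) : Fin n := if c k = c j then c i else c k

theorem exists_last (c : Fin n → Fin n) (i : Fin n) : ∃ k, c k = c i ∧ ∀ l, c l = c i → l ≤ k := by
  obtain ⟨k, hk, h⟩ := Set.exists_max_image {k | c k = c i} id (Set.toFinite _) ⟨i, rfl⟩
  exact ⟨k, hk, h⟩

theorem exists_first (c : Fin n → Fin n) (i : Fin n) :
    ∃ k, c k = c i ∧ ∀ l, c l = c i → k ≤ l := by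
  obtain ⟨k, hk, h⟩ := Set.exists_min_image {k | c k = c i} id (Set.toFinite _) ⟨i, rfl⟩
  exact ⟨k, hk, h⟩

namespace IsBlocks

variable {E : Set (Fin n)} {c : Fin n → Fin n} {P Θ : Set (Fin n → ℂ)} {i j k l : Fin n}
  {s : Perm (Fin n)}

theorem mem_of_color (h : IsBlocks E c P Θ) (hi : i ∈ E) (hk : c k = c i) : k ∈ E := by
  rcases h.outside _ _ hk with rfl | h
  · exact hi
  · exact h.1

theorem color_lt (h : IsBlocks E c P Θ) (hi : i ∈ E) (hj : j ∈ E) (hij : i < j)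
    (hc : c i ≠ c j) : c i < c j :=
  (h.mono hi hj hij.le).lt_of_ne hc

theorem lt_of_color_lt (h : IsBlocks E c P Θ) (hi : i ∈ E) (hj : j ∈ E) (hc : c i < c j) :
    i < j := by
  by_contra hle
  exact not_le.2 hc (h.mono hj hi (not_lt.1 hle))

/-- The indicator function of a colour class lies in `𝔞_Θ`, and there the root `e i - e j` takes
the value of `e (c i) - e (c j)` at this class. -/
theorem exists_indicator (h : IsBlocks E c P Θ) (a : Fin n) : ∃ H : kerSpace Θ,
    ∀ i j, restr Θ (e i - e j) H = (e (c i) - e (c j)) a := by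
  refine ⟨⟨fun k => if c k = a then 1 else 0, ?_⟩, fun i j => ?_⟩
  · rw [h.theta_eq]
    rintro _ ⟨i, j, hij, rfl⟩
    rw [sub_dotProduct_e, hij.2.1, sub_self]
  · rw [restr, sub_dotProduct_e, Pi.sub_apply, e_apply, e_apply]
    simp only [eq_comm]

theorem restr_sub_congr (h : IsBlocks E c P Θ) (hi : c i = c k) (hj : c j = c l) :
    restr Θ (e i - e j) = restr Θ (e k - e l) := by
  funext H
  have hH : ∀ i j, c i = c j → H.1 i = H.1 j := by
    have : ∀ i j, i < j → c i = c j → H.1 i = H.1 j := fun i j hij hc =>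
      rel_of_consec (Q := fun i j => H.1 i = H.1 j) (fun _ _ _ => Eq.trans) (fun i j hij => by
        have := H.2 (e i - e j) (by rw [h.theta_eq]; exact ⟨i, j, hij, rfl⟩)
        rwa [sub_dotProduct_e, sub_eq_zero] at this) hij hc
    intro i j hc
    rcases lt_trichotomy i j with hij | rfl | hij
    · exact this i j hij hc
    · rfl
    · exact (this j i hij hc.symm).symm
  rw [restr, restr, sub_dotProduct_e, sub_dotProduct_e, hH _ _ hi, hH _ _ hj]

theorem lineRoots_eq (h : IsBlocks E c P Θ) (hi : i ∈ E) (hj : j ∈ E) (hij : i < j)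
    (hc : c i ≠ c j) :
    lineRoots P Θ (e i - e j) = rootsOf fun k l => k < l ∧ merge c i j k = merge c i j l := by
  ext β
  constructor
  · rintro ⟨hβ, r, hr⟩
    rw [h.pos_eq] at hβ
    obtain ⟨k, l, ⟨hkl, -, -⟩, rfl⟩ := hβ
    refine ⟨k, l, ⟨hkl, ?_⟩, rfl⟩
    by_cases hckl : c k = c l
    · rw [merge, merge, hckl]
    have key : ∀ a, (e (c k) - e (c l)) a = r * (e (c i) - e (c j)) a := fun a => by
      obtain ⟨H, hH⟩ := h.exists_indicator a
      rw [← hH, ← hH, hr, Pi.smul_apply, smul_eq_mul]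
    have mem : ∀ a, (e (c k) - e (c l)) a ≠ 0 → a = c i ∨ a = c j := fun a ha => by
      by_contra! hne
      rw [key, Pi.sub_apply, e_apply, e_apply, if_neg hne.1, if_neg hne.2] at ha
      simp at ha
    have hk := mem (c k) (by simp [e_apply, hckl])
    have hl := mem (c l) (by simp [e_apply, Ne.symm hckl])
    unfold merge
    grind
  · rintro ⟨k, l, ⟨hkl, hm⟩, rfl⟩
    have hcase : c k = c l ∨ (c k = c i ∧ c l = c j) ∨ (c k = c j ∧ c l = c i) := by
      unfold merge at hm
      grind
    have hE : k ∈ E ∧ l ∈ E := by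
      rcases hcase with h1 | h1 | h1
      · exact (h.outside _ _ h1).resolve_left hkl.ne
      · exact ⟨h.mem_of_color hi h1.1, h.mem_of_color hj h1.2⟩
      · exact ⟨h.mem_of_color hj h1.1, h.mem_of_color hi h1.2⟩
    refine ⟨by rw [h.pos_eq]; exact ⟨k, l, ⟨hkl, hE⟩, rfl⟩, ?_⟩
    rcases hcase with h1 | h1 | h1
    · refine ⟨0, ?_⟩
      rw [h.restr_sub_congr h1 rfl]
      funext H
      simp [restr]
    · exact ⟨1, by rw [h.restr_sub_congr h1.1 h1.2]; simp⟩
    · have := h.mono hE.1 hE.2 hkl.le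
      rw [h1.1, h1.2] at this
      exact absurd (le_antisymm (h.mono hi hj hij.le) this) hc

/-- The properties of `σ_α = w^α w_Θ` that hold for all `α`: it increases on the blocks, and it
reverses the order of the two blocks that belong to `α`. -/
theorem isSigma_spec (h : IsBlocks E c P Θ) (hi : i ∈ E) (hj : j ∈ E) (hij : i < j)
    (hc : c i ≠ c j) (hs : IsSigma P Θ (e i - e j) s) :
    (∀ k l, c k = c l → k < l → s k < s l) ∧
    (∀ k l, c k = c i → c l = c j → s l < s k) ∧
    ∀ k, merge c i j (s k) = merge c i j k := by
  obtain ⟨u, v, hu, hv, rfl⟩ := hs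
  rw [h.lineRoots_eq hi hj hij hc, simples_rootsOf_color, reflections_consec] at hu
  rw [h.theta_eq, reflections_consec] at hv
  obtain ⟨hu, hu'⟩ := isLongest_adjSwaps hu
  obtain ⟨hv, hv'⟩ := isLongest_adjSwaps hv
  have hm : ∀ k l, c k = c l → merge c i j k = merge c i j l := fun k l hkl => by
    rw [merge, merge, hkl]
  refine ⟨fun k l hkl hlt => ?_, fun k l hk hl => ?_, fun k => ?_⟩
  · exact hu' _ _ (hv' _ _ hlt hkl) (hm _ _ (by rw [hv, hv, hkl]))
  · have hk' : c (v k) = c i := (hv k).trans hk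
    have hl' : c (v l) = c j := (hv l).trans hl
    refine hu' _ _ (h.lt_of_color_lt (h.mem_of_color hi hk') (h.mem_of_color hj hl') ?_) ?_
    · rw [hk', hl']
      exact h.color_lt hi hj hij hc
    · simp [merge, hk', hl', hc]
  · exact (hu _).trans (hm _ _ (hv _))

theorem swapsClasses_of_sq (h : IsBlocks E c P Θ) (hi : i ∈ E) (hj : j ∈ E) (hij : i < j)
    (hc : c i ≠ c j) (hs : IsSigma P Θ (e i - e j) s) (hsq : s * s = 1) :
    SwapsClasses c (c i) (c j) s := by
  obtain ⟨h1, h2, h3⟩ := h.isSigma_spec hi hj hij hc hs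
  have hss : ∀ k, s (s k) = k := fun k => by rw [← Perm.mul_apply, hsq, Perm.one_apply]
  have hfix : ∀ k, c (s k) = c k → s k = k := fun k hk => by
    rcases lt_trichotomy (s k) k with hlt | heq | hlt
    · have := h1 _ _ hk hlt
      rw [hss] at this
      exact absurd this (lt_asymm hlt)
    · exact heq
    · have := h1 _ _ hk.symm hlt
      rw [hss] at this
      exact absurd this (lt_asymm hlt)
  have hlt : ∀ k l, c k = c i → c l = c j → k < l := fun k l hk hl =>
    h.lt_of_color_lt (h.mem_of_color hi hk) (h.mem_of_color hj hl) (by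
      rw [hk, hl]
      exact h.color_lt hi hj hij hc)
  have hcol : ∀ k, c k = c i ∨ c k = c j → c (s k) = c i ∨ c (s k) = c j := fun k hk => by
    have := h3 k
    unfold merge at this
    grind
  refine ⟨fun k hk => ?_, fun k hk => ?_, fun k hk hk' => hfix k ?_, h1, hsq⟩
  · refine (hcol k (Or.inl hk)).resolve_left fun hsk => ?_
    -- `k` is fixed, and so the class of `j` would be mapped to the left of `k`
    have hk' := hfix k (hsk.trans hk.symm)
    have hj1 := h2 k j hk rfl
    rw [hk'] at hj1
    rcases hcol j (Or.inr rfl) with hj2 | hj2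
    · have := h1 _ _ (hj2.trans hk.symm) hj1
      rw [hss, hk'] at this
      exact lt_asymm this (hlt k j hk rfl)
    · exact lt_asymm hj1 (hlt _ _ hk hj2)
  · refine (hcol k (Or.inr hk)).resolve_right fun hsk => ?_
    have hk' := hfix k (hsk.trans hk.symm)
    have hj1 := h2 i k rfl hk
    rw [hk'] at hj1
    rcases hcol i (Or.inl rfl) with hj2 | hj2
    · exact lt_asymm hj1 (hlt _ _ hj2 hk)
    · have := h1 _ _ (hk.trans hj2.symm) hj1
      rw [hss, hk'] at this
      exact lt_asymm this (hlt i k rfl hk)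
  · have := h3 k
    unfold merge at this
    grind

theorem swapsClasses_of_size (h : IsBlocks E c P Θ) (hi : i ∈ E) (hj : j ∈ E) (hij : i < j)
    (hc : c i ≠ c j) (hs : IsSigma P Θ (e i - e j) s)
    (hsize : classSize c (c i) = classSize c (c j)) : SwapsClasses c (c i) (c j) s := by
  refine h.swapsClasses_of_sq hi hj hij hc hs ?_
  obtain ⟨h1, h2, h3⟩ := h.isSigma_spec hi hj hij hc hs
  have hlt : ∀ k l, c k = c i → c l = c j → k < l := fun k l hk hl =>
    h.lt_of_color_lt (h.mem_of_color hi hk) (h.mem_of_color hj hl) (by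
      rw [hk, hl]
      exact h.color_lt hi hj hij hc)
  have hcol : ∀ k, c k = c i ∨ c k = c j → c (s k) = c i ∨ c (s k) = c j := fun k hk => by
    have := h3 k
    unfold merge at this
    grind
  have hl : ∀ k, c k = c i → c (s k) = c j := fun k hk => by
    refine (hcol k (Or.inl hk)).resolve_left fun hsk => ?_
    refine (classSize_lt (a := c j) s hsk fun l hl => ⟨?_, (h2 k l hk hl).ne⟩).ne hsize.symm
    exact (hcol l (Or.inr hl)).resolve_right fun hsl => lt_asymm (h2 k l hk hl) (hlt _ _ hsk hsl)
  have hr : ∀ k, c k = c j → c (s k) = c i := fun k hk => by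
    refine (hcol k (Or.inr hk)).resolve_right fun hsk => ?_
    refine (classSize_lt (a := c i) s hsk fun l hl => ⟨?_, (h2 l k hl hk).ne'⟩).ne hsize
    exact (hcol l (Or.inl hl)).resolve_left fun hsl => lt_asymm (h2 l k hl hk) (hlt _ _ hsl hsk)
  have ho : ∀ k, c k ≠ c i → c k ≠ c j → c (s k) = c k := fun k _ _ => by
    have := h3 k
    unfold merge at this
    grind
  refine eq_one_of_increasing (c := c) (fun k => ?_) fun k l hkl hc => ?_
  · rw [Perm.mul_apply]
    grind
  · refine h1 _ _ ?_ (h1 _ _ hc hkl)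
    grind

theorem orderOf_eq_two_iff (h : IsBlocks E c P Θ) (hi : i ∈ E) (hj : j ∈ E) (hij : i < j)
    (hc : c i ≠ c j) (hs : IsSigma P Θ (e i - e j) s) :
    orderOf s = 2 ↔ classSize c (c i) = classSize c (c j) := by
  rw [orderOf_eq_prime_iff, pow_two]
  constructor
  · rintro ⟨hsq, -⟩
    have := h.swapsClasses_of_sq hi hj hij hc hs hsq
    exact le_antisymm (classSize_le s this.left) (classSize_le s this.right)
  · intro hsize
    have := h.swapsClasses_of_size hi hj hij hc hs hsize
    refine ⟨this.sq, fun h1 => hc ?_⟩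
    have := this.left i rfl
    rwa [h1] at this

theorem isUseful_iff (h : IsBlocks E c P Θ) (hi : i ∈ E) (hj : j ∈ E) (hij : i < j)
    (hc : c i ≠ c j) :
    IsUseful P Θ (e i - e j) ↔ classSize c (c i) = classSize c (c j) := by
  constructor
  · rintro ⟨s, hs, ho⟩
    exact (h.orderOf_eq_two_iff hi hj hij hc hs).1 ho
  · intro hsize
    obtain ⟨u, hu⟩ := exists_isLongest (reflections (simples (lineRoots P Θ (e i - e j))))
    obtain ⟨v, hv⟩ := exists_isLongest (reflections Θ)
    have hs : IsSigma P Θ (e i - e j) (u * v) := ⟨u, v, hu, hv, rfl⟩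
    exact ⟨_, hs, (h.orderOf_eq_two_iff hi hj hij hc hs).2 hsize⟩

theorem mem_usefulReduced (h : IsBlocks E c P Θ) (hi : i ∈ E) (hj : j ∈ E) (hij : i < j) :
    e i - e j ∈ usefulReduced P Θ ↔ c i ≠ c j ∧ classSize c (c i) = classSize c (c j) ∧
      ∀ k, i < k → k < j → c k ≠ c i ∧ c k ≠ c j := by
  constructor
  · rintro ⟨-, hu, hne, hmem, -⟩
    have hc : c i ≠ c j := fun hc => hne <| by
      rw [h.restr_sub_congr hc rfl]
      funext H
      simp [restr]
    refine ⟨hc, (h.isUseful_iff hi hj hij hc).1 hu, fun k h1 h2 => ?_⟩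
    rw [h.lineRoots_eq hi hj hij hc, simples_rootsOf_color, mem_rootsOf hij.ne] at hmem
    have := hmem.2.2 k h1 h2
    unfold merge at this
    grind
  · rintro ⟨hc, hsize, hk⟩
    refine ⟨by rw [h.pos_eq]; exact ⟨i, j, ⟨hij, hi, hj⟩, rfl⟩,
      (h.isUseful_iff hi hj hij hc).2 hsize, fun h0 => ?_, ?_, ?_⟩
    · obtain ⟨H, hH⟩ := h.exists_indicator (c i)
      have := hH i j
      rw [h0] at this
      simp [e_apply, hc] at this
    · rw [h.lineRoots_eq hi hj hij hc, simples_rootsOf_color, mem_rootsOf hij.ne]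
      refine ⟨hij, by simp [merge], fun k h1 h2 => ?_⟩
      have := hk k h1 h2
      unfold merge
      grind
    · rw [h.theta_eq, mem_rootsOf hij.ne]
      exact fun h1 => hc h1.2.1

/-- The last element of one class and the first element of a later class of the same size form
a useful reduced root. -/
theorem exists_usefulReduced (h : IsBlocks E c P Θ) (hi : i ∈ E) (hj : j ∈ E) (hij : i < j)
    (hc : c i ≠ c j) (hsize : classSize c (c i) = classSize c (c j)) :
    ∃ k l, k ∈ E ∧ l ∈ E ∧ k < l ∧ c k = c i ∧ c l = c j ∧ e k - e l ∈ usefulReduced P Θ := by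
  obtain ⟨k, hk, hk'⟩ := exists_last c i
  obtain ⟨l, hl, hl'⟩ := exists_first c j
  have hkE := h.mem_of_color hi hk
  have hlE := h.mem_of_color hj hl
  have hkl : k < l := h.lt_of_color_lt hkE hlE (by
    rw [hk, hl]
    exact h.color_lt hi hj hij hc)
  refine ⟨k, l, hkE, hlE, hkl, hk, hl, (h.mem_usefulReduced hkE hlE hkl).2 ⟨?_, ?_, ?_⟩⟩
  · rwa [hk, hl]
  · rwa [hk, hl]
  · refine fun m h1 h2 => ⟨fun h3 => ?_, fun h3 => ?_⟩
    · exact not_le.2 h1 (hk' m (h3.trans hk))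
    · exact not_le.2 h2 (hl' m (h3.trans hl))

theorem mem_restr_image (h : IsBlocks E c P Θ) {γ : kerSpace Θ → ℂ} :
    γ ∈ restr Θ '' usefulReduced P Θ ↔ ∃ i j, i ∈ E ∧ j ∈ E ∧ i < j ∧ c i ≠ c j ∧
      classSize c (c i) = classSize c (c j) ∧ γ = restr Θ (e i - e j) := by
  constructor
  · rintro ⟨α, hα, rfl⟩
    have hαP := hα.1
    rw [h.pos_eq] at hαP
    obtain ⟨i, j, ⟨hij, hi, hj⟩, rfl⟩ := hαP
    obtain ⟨h1, h2, -⟩ := (h.mem_usefulReduced hi hj hij).1 hα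
    exact ⟨i, j, hi, hj, hij, h1, h2, rfl⟩
  · rintro ⟨i, j, hi, hj, hij, hc, hsize, rfl⟩
    obtain ⟨k, l, -, -, -, hk, hl, hmem⟩ := h.exists_usefulReduced hi hj hij hc hsize
    exact ⟨_, hmem, h.restr_sub_congr hk hl⟩

/-- The restriction of `e i - e j` is simple if and only if no class of the same size lies
strictly between those of `i` and `j`. -/
theorem mem_usefulSimple (h : IsBlocks E c P Θ) (hi : i ∈ E) (hj : j ∈ E) (hij : i < j)
    (hc : c i ≠ c j) (hsize : classSize c (c i) = classSize c (c j)) :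
    restr Θ (e i - e j) ∈ usefulSimple P Θ ↔
      ∀ k ∈ E, i < k → k < j → classSize c (c k) = classSize c (c i) → c k = c i ∨ c k = c j := by
  constructor
  · rintro ⟨-, hns⟩ k hk hik hkj hsk
    by_contra! hne
    refine hns ⟨_, h.mem_restr_image.2 ⟨i, k, hi, hk, hik, hne.1.symm, hsk.symm, rfl⟩,
      _, h.mem_restr_image.2 ⟨k, j, hk, hj, hkj, hne.2, hsk.trans hsize, rfl⟩, ?_⟩
    funext H
    simp only [restr, Pi.add_apply, sub_dotProduct_e]
    ring
  · intro hk
    refine ⟨h.mem_restr_image.2 ⟨i, j, hi, hj, hij, hc, hsize, rfl⟩, ?_⟩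
    rintro ⟨β, hβ, γ, hγ, he⟩
    obtain ⟨a, b, ha, hb, hab, hcab, hsab, rfl⟩ := h.mem_restr_image.1 hβ
    obtain ⟨a', b', ha', hb', hab', hcab', hsab', rfl⟩ := h.mem_restr_image.1 hγ
    have he' : e (c i) - e (c j) = (e (c a) - e (c b)) + (e (c a') - e (c b')) := by
      funext m
      obtain ⟨H, hH⟩ := h.exists_indicator m
      rw [Pi.add_apply, ← hH, ← hH, ← hH, he, Pi.add_apply]
    -- in either order of the two summands, the class in the middle is one that `hk` excludes
    have key : ∀ a b a' b', a ∈ E → b ∈ E → a' ∈ E → b' ∈ E → a < b → a' < b' → c a ≠ c b →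
        c a' ≠ c b' → classSize c (c a) = classSize c (c b) →
        c i = c a → c b = c a' → c b' = c j → False := by
      intro a b a' b' ha hb ha' hb' hab hab' h1 h2 h3 h4 h5 h6
      have h7 : c i < c b := h4 ▸ h.color_lt ha hb hab h1
      have h8 : c b < c j := by
        rw [h5, ← h6]
        exact h.color_lt ha' hb' hab' h2
      rcases hk b hb (h.lt_of_color_lt hi hb h7) (h.lt_of_color_lt hb hj h8)
        (by rw [← h3, h4]) with h9 | h9
      · exact h7.ne' h9
      · exact h8.ne h9
    rcases root_eq_add hc hcab hcab' he' with ⟨h1, h2, h3⟩ | ⟨h1, h2, h3⟩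
    · exact key a b a' b' ha hb ha' hb' hab hab' hcab hcab' hsab h1 h2 h3
    · exact key a' b' a b ha' hb' ha hb hab' hab hcab' hcab hsab' h1 h2 h3

theorem exists_of_mem_usefulGens (h : IsBlocks E c P Θ) (hs : s ∈ usefulGens P Θ) :
    ∃ i j, i ∈ E ∧ j ∈ E ∧ i < j ∧ c i ≠ c j ∧ classSize c (c i) = classSize c (c j) ∧
      (∀ k ∈ E, i < k → k < j → classSize c (c k) = classSize c (c i) → c k = c i ∨ c k = c j) ∧
      SwapsClasses c (c i) (c j) s := by
  obtain ⟨α, hα, hsimple, hsigma⟩ := hs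
  have hαP := hα.1
  rw [h.pos_eq] at hαP
  obtain ⟨i, j, ⟨hij, hi, hj⟩, rfl⟩ := hαP
  obtain ⟨h1, h2, -⟩ := (h.mem_usefulReduced hi hj hij).1 hα
  exact ⟨i, j, hi, hj, hij, h1, h2, (h.mem_usefulSimple hi hj hij h1 h2).1 hsimple,
    h.swapsClasses_of_size hi hj hij h1 hsigma h2⟩

theorem exists_mem_usefulGens (h : IsBlocks E c P Θ) (hi : i ∈ E) (hj : j ∈ E) (hij : i < j)
    (hc : c i ≠ c j) (hsize : classSize c (c i) = classSize c (c j))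
    (hk : ∀ k ∈ E, i < k → k < j → classSize c (c k) = classSize c (c i) →
      c k = c i ∨ c k = c j) :
    ∃ s ∈ usefulGens P Θ, SwapsClasses c (c i) (c j) s := by
  obtain ⟨a, b, ha, hb, hab, hca, hcb, hmem⟩ := h.exists_usefulReduced hi hj hij hc hsize
  obtain ⟨s, hs, -⟩ := hmem.2.1
  refine ⟨s, ⟨_, hmem, ?_, hs⟩, ?_⟩
  · rw [h.restr_sub_congr hca hcb]
    exact (h.mem_usefulSimple hi hj hij hc hsize).2 hk
  · rw [← hca, ← hcb] at hc hsize ⊢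
    exact h.swapsClasses_of_size ha hb hab hc hs hsize

end IsBlocks

end Blocks

/-! ### The stabilizer of a set of simple roots -/

section Stabilizer

open Equiv

variable {n : ℕ}

/-- `ρ i` is the first element of the block of `i`, where the blocks are the intervals of indices
that are linked by the simple roots in `Θ`. -/
structure IsBlockStart (ρ : Fin n → Fin n) (Θ : Set (Fin n → ℂ)) : Prop where
  mono : Monotone ρ
  le : ∀ i, ρ i ≤ i
  idem : ∀ i, ρ (ρ i) = ρ i
  theta_eq : Θ = rootsOf (Consec ρ)

theorem posRoots_eq : posRoots n = rootsOf fun i j => i < j := rfl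

theorem simpleRoots_eq : simpleRoots n = rootsOf (Consec fun _ : Fin n => ()) := by
  rw [← simples_rootsOf_color, simpleRoots, posRoots_eq]
  simp

theorem exists_blockStart {Θ : Set (Fin n → ℂ)} (hΘ : Θ ⊆ simpleRoots n) :
    ∃ ρ : Fin n → Fin n, IsBlockStart ρ Θ := by
  rw [simpleRoots_eq] at hΘ
  have hcov : ∀ i j, e i - e j ∈ Θ → i ≠ j → i < j ∧ ∀ k, i < k → ¬ k < j := fun i j h hne => by
    have := (mem_rootsOf hne).1 (hΘ h)
    exact ⟨this.1, fun k h1 h2 => this.2.2 k h1 h2 rfl⟩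
  -- the blocks start at the indices where no root of `Θ` ends
  have hex : ∀ i : Fin n, ∃ a, (a ≤ i ∧ ∀ k, k ≠ a → e k - e a ∉ Θ) ∧
      ∀ b, b ≤ i → (∀ k, k ≠ b → e k - e b ∉ Θ) → b ≤ a := by
    intro i
    obtain ⟨a, ha, h⟩ := Set.exists_max_image {a | a ≤ i ∧ ∀ k, k ≠ a → e k - e a ∉ Θ} id
      (Set.toFinite _) ⟨⟨0, i.pos⟩, Fin.mk_le_of_le_val (Nat.zero_le _), fun k hk hmem =>
        Nat.not_lt_zero _ (Fin.lt_def.1 (hcov _ _ hmem hk).1)⟩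
    exact ⟨a, ha, fun b h1 h2 => h b ⟨h1, h2⟩⟩
  choose ρ hρ hmax using hex
  have hmono : Monotone ρ := fun i j hij => hmax j _ ((hρ i).1.trans hij) (hρ i).2
  refine ⟨ρ, hmono, fun i => (hρ i).1, fun i => ?_, ?_⟩
  · exact le_antisymm (hρ _).1 (hmax _ _ le_rfl (hρ i).2)
  · ext α
    constructor
    · intro hα
      obtain ⟨i, j, hij, rfl⟩ := hΘ hα
      have hlt := hij.1
      have hne : ρ j ≠ j := fun he => (hρ j).2 i (by rw [he]; exact hlt.ne) (by rwa [he])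
      have hle : ρ j ≤ i := by
        by_contra h
        exact (hcov i j hα hlt.ne).2 _ (not_le.1 h) ((hρ j).1.lt_of_ne hne)
      refine ⟨i, j, ⟨hlt, le_antisymm (hmono hlt.le) (hmax i _ hle (hρ j).2), ?_⟩, rfl⟩
      exact fun k h1 h2 => absurd h2 ((hcov i j hα hlt.ne).2 k h1)
    · rintro ⟨i, j, ⟨hij, hc, hk⟩, rfl⟩
      have hstart : ¬ ∀ k, k ≠ j → e k - e j ∉ Θ := fun h => by
        have := hmax j j le_rfl h
        rw [← hc] at this
        exact not_lt.2 (this.trans (hρ i).1) hij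
      push Not at hstart
      obtain ⟨k, hkj, hmem⟩ := hstart
      obtain ⟨hlt, hcov⟩ := hcov k j hmem hkj
      rcases lt_trichotomy i k with h | rfl | h
      · refine absurd (le_antisymm ?_ (hmono h.le)) (hk k h hlt)
        rw [hc]
        exact hmono hlt.le
      · exact hmem
      · exact absurd hij (hcov i h)

/-- The stabilizer `W(Θ)` as a subgroup of the Weyl group. -/
def stabGroup (Θ : Set (Fin n → ℂ)) : Subgroup (Perm (Fin n)) where
  carrier := stab Θ
  mul_mem' := fun {a b} (ha : act a '' Θ = Θ) (hb : act b '' Θ = Θ) => by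
    have : act (a * b) = act a ∘ act b := rfl
    change act (a * b) '' Θ = Θ
    rw [this, Set.image_comp, hb, ha]
  one_mem' := by
    have : act (1 : Perm (Fin n)) = id := rfl
    change act 1 '' Θ = Θ
    rw [this, Set.image_id]
  inv_mem' := fun {a} (ha : act a '' Θ = Θ) => by
    have : act a⁻¹ ∘ act a = id := by
      funext v i
      simp [act]
    change act a⁻¹ '' Θ = Θ
    conv_lhs => rw [← ha]
    rw [← Set.image_comp, this, Set.image_id]

namespace IsBlockStart

variable {ρ : Fin n → Fin n} {Θ : Set (Fin n → ℂ)} {w : Perm (Fin n)} {i j : Fin n}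

theorem consec_apply (h : IsBlockStart ρ Θ) (hw : w ∈ stabGroup Θ) (hij : Consec ρ i j) :
    Consec ρ (w i) (w j) := by
  have hw : act w '' Θ = Θ := hw
  have hmem : act w (e i - e j) ∈ act w '' Θ :=
    ⟨_, by rw [h.theta_eq]; exact ⟨i, j, hij, rfl⟩, rfl⟩
  rwa [hw, h.theta_eq, act_root, mem_rootsOf (w.injective.ne hij.1.ne)] at hmem

theorem not_lt_of_consec (h : IsBlockStart ρ Θ) (hij : Consec ρ i j) {k : Fin n} (hik : i < k) :
    ¬ k < j := fun hkj => by
  refine hij.2.2 k hik hkj (le_antisymm ?_ (h.mono hik.le))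
  rw [hij.2.1]
  exact h.mono hkj.le

theorem apply_lt (h : IsBlockStart ρ Θ) (hw : w ∈ stabGroup Θ) (hij : i < j) (hc : ρ i = ρ j) :
    w i < w j :=
  rel_of_consec (Q := fun i j => w i < w j) (fun _ _ _ => lt_trans)
    (fun _ _ hij => (h.consec_apply hw hij).1) hij hc

theorem color_apply (h : IsBlockStart ρ Θ) (hw : w ∈ stabGroup Θ) (hc : ρ i = ρ j) :
    ρ (w i) = ρ (w j) := by
  have key : ∀ i j, i < j → ρ i = ρ j → ρ (w i) = ρ (w j) := fun i j hij hc =>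
    rel_of_consec (Q := fun i j => ρ (w i) = ρ (w j)) (fun _ _ _ => Eq.trans)
      (fun _ _ hij => (h.consec_apply hw hij).2.1) hij hc
  rcases lt_trichotomy i j with hij | rfl | hij
  · exact key i j hij hc
  · rfl
  · exact (key j i hij hc.symm).symm

/-- The stabilizer of `Θ` maps the first element of a block to the first element of a block. -/
theorem apply_start (h : IsBlockStart ρ Θ) (hw : w ∈ stabGroup Θ) (i : Fin n) :
    ρ (w i) = w (ρ i) := by
  have hk : w (w⁻¹ (ρ (w i))) = ρ (w i) := perm_apply_inv _ _
  have hc : ρ (w⁻¹ (ρ (w i))) = ρ i := by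
    have := h.color_apply ((stabGroup Θ).inv_mem hw) (h.idem (w i))
    simpa using this
  have hle : ρ i ≤ w⁻¹ (ρ (w i)) := hc ▸ h.le _
  rcases hle.eq_or_lt with heq | hlt
  · rw [heq, hk]
  · have h1 := h.apply_lt hw hlt ((h.idem i).trans hc.symm)
    rw [hk] at h1
    have h2 : ρ (w i) ≤ w (ρ i) := by
      rw [← h.color_apply hw (h.idem i)]
      exact h.le _
    exact absurd h1 (not_lt.2 h2)

theorem apply_eq_self_iff (h : IsBlockStart ρ Θ) (hw : w ∈ stabGroup Θ) (hij : Consec ρ i j) :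
    w i = i ↔ w j = j := by
  have h1 := h.consec_apply hw hij
  constructor
  · intro hi
    rw [hi] at h1
    exact le_antisymm (not_lt.1 (h.not_lt_of_consec h1 hij.1))
      (not_lt.1 (h.not_lt_of_consec hij h1.1))
  · intro hj
    rw [hj] at h1
    exact le_antisymm (not_lt.1 fun hlt => h.not_lt_of_consec hij hlt h1.1)
      (not_lt.1 fun hlt => h.not_lt_of_consec h1 hlt hij.1)

theorem apply_eq_self (h : IsBlockStart ρ Θ) (hw : w ∈ stabGroup Θ) (hi : w (ρ i) = ρ i) :
    w i = i := by
  rcases (h.le i).eq_or_lt with heq | hlt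
  · rwa [heq] at hi
  · exact (rel_of_consec (Q := fun i j => w i = i ↔ w j = j) (fun _ _ _ => Iff.trans)
      (fun _ _ => h.apply_eq_self_iff hw) hlt (h.idem i)).1 hi

/-- The permutation of the set of blocks that is induced by an element of the stabilizer.  A block
is represented by its first element. -/
def blockPerm (h : IsBlockStart ρ Θ) : stabGroup Θ →* Perm {i // ρ i = i} where
  toFun w := w.1.subtypePerm fun i => by
    rw [h.apply_start w.2, w.1.injective.eq_iff]
  map_one' := rfl
  map_mul' _ _ := rfl

theorem coe_blockPerm (h : IsBlockStart ρ Θ) (w : stabGroup Θ) (u : {i // ρ i = i}) :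
    (h.blockPerm w u : Fin n) = w.1 u := rfl

theorem blockPerm_injective (h : IsBlockStart ρ Θ) : Function.Injective h.blockPerm := by
  rw [injective_iff_map_eq_one]
  intro w hw
  ext1
  refine Equiv.ext fun i => h.apply_eq_self w.2 ?_
  have := congrArg Subtype.val (DFunLike.congr_fun hw ⟨ρ i, h.idem i⟩)
  rwa [h.coe_blockPerm] at this

/-- The size of a block. -/
noncomputable def blockSize (ρ : Fin n → Fin n) (u : {i // ρ i = i}) : ℕ := classSize ρ u

theorem blockPerm_mem_colorPerms (h : IsBlockStart ρ Θ) (w : stabGroup Θ) :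
    h.blockPerm w ∈ colorPerms (blockSize ρ) := by
  intro u
  unfold blockSize
  rw [h.coe_blockPerm]
  refine le_antisymm (classSize_le w.1⁻¹ fun k hk => ?_) (classSize_le w.1 fun k hk => ?_)
  · rw [h.apply_start ((stabGroup Θ).inv_mem w.2), hk]
    simp
  · rw [h.apply_start w.2, hk]

theorem isBlocks (h : IsBlockStart ρ Θ) : IsBlocks Set.univ ρ (posRoots n) Θ where
  mono := h.mono.monotoneOn _
  outside _ _ _ := Or.inr ⟨trivial, trivial⟩
  pos_eq := by simp [posRoots_eq]
  theta_eq := h.theta_eq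

theorem mem_stabGroup_of_swapsClasses (h : IsBlockStart ρ Θ) {a b : Fin n}
    (hw : SwapsClasses ρ a b w) : w ∈ stabGroup Θ := by
  have hss : ∀ k, w (w k) = k := fun k => by rw [← Perm.mul_apply, hw.sq, Perm.one_apply]
  have hcol : ∀ k l, ρ k = ρ l → ρ (w k) = ρ (w l) := fun k l hkl => by
    by_cases ha : ρ k = a
    · rw [hw.left k ha, hw.left l (hkl ▸ ha)]
    · by_cases hb : ρ k = b
      · rw [hw.right k hb, hw.right l (hkl ▸ hb)]
      · rw [hw.other k ha hb, hw.other l (hkl ▸ ha) (hkl ▸ hb), hkl]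
  have hmaps : ∀ θ ∈ Θ, act w θ ∈ Θ := by
    rw [h.theta_eq]
    rintro _ ⟨i, j, hij, rfl⟩
    rw [act_root]
    refine ⟨_, _, ⟨hw.incr _ _ hij.2.1 hij.1, hcol _ _ hij.2.1, fun k h1 h2 h3 => ?_⟩, rfl⟩
    have h4 := hw.incr _ _ h3.symm h1
    have h5 := hw.incr _ _ (h3.trans (hcol _ _ hij.2.1)) h2
    rw [hss] at h4 h5
    exact h.not_lt_of_consec hij h4 h5
  refine Set.Subset.antisymm (Set.image_subset_iff.2 hmaps) fun θ hθ => ⟨_, hmaps θ hθ, ?_⟩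
  have : act w (act w θ) = act (w * w) θ := rfl
  rw [this, hw.sq]
  rfl

theorem blockPerm_eq_swap (h : IsBlockStart ρ Θ) {a b : {i // ρ i = i}} (w : stabGroup Θ)
    (hw : SwapsClasses ρ a b w.1) : h.blockPerm w = swap a b := by
  refine Equiv.ext fun u => Subtype.ext ?_
  rw [h.coe_blockPerm, swap_apply_def]
  have hstart : ρ (w.1 u) = w.1 u := by rw [h.apply_start w.2, u.2]
  split_ifs with h1 h2
  · rw [← hstart]
    exact hw.left _ (by rw [u.2, h1])
  · rw [← hstart]
    exact hw.right _ (by rw [u.2, h2])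
  · exact hw.other _ (fun h3 => h1 (Subtype.ext (u.2.symm.trans h3)))
      fun h3 => h2 (Subtype.ext (u.2.symm.trans h3))

theorem usefulGens_subset (h : IsBlockStart ρ Θ) {s : Perm (Fin n)}
    (hs : s ∈ usefulGens (posRoots n) Θ) : s ∈ stabGroup Θ := by
  obtain ⟨i, j, -, -, -, -, -, -, hsw⟩ := h.isBlocks.exists_of_mem_usefulGens hs
  exact h.mem_stabGroup_of_swapsClasses hsw

/-- The generators `S(Θ)` are the exchanges of consecutive blocks of the same size. -/
theorem image_usefulGens (h : IsBlockStart ρ Θ) :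
    h.blockPerm '' {s | s.1 ∈ usefulGens (posRoots n) Θ} = adjSwaps (blockSize ρ) := by
  ext t
  constructor
  · rintro ⟨s, hs, rfl⟩
    obtain ⟨i, j, -, -, hij, hc, hsize, hk, hsw⟩ := h.isBlocks.exists_of_mem_usefulGens hs
    refine ⟨⟨ρ i, h.idem i⟩, ⟨ρ j, h.idem j⟩, ⟨?_, hsize, fun u h1 h2 h3 => ?_⟩,
      h.blockPerm_eq_swap s hsw⟩
    · exact (h.mono hij.le).lt_of_ne hc
    · have h1 : ρ i < u := h1
      have h2 : (u : Fin n) < ρ j := h2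
      rcases hk u trivial (h.mono.reflect_lt (by rwa [u.2])) (h2.trans_le (h.le j))
        (by rw [u.2]; exact h3) with h4 | h4
      · exact h1.ne (h4.symm.trans u.2)
      · exact h2.ne (u.2.symm.trans h4)
  · rintro ⟨u, v, huv, rfl⟩
    have hlt : (u : Fin n) < v := huv.1
    have hs := h.isBlocks.exists_mem_usefulGens (i := u) (j := v) trivial trivial hlt
      (by rw [u.2, v.2]; exact hlt.ne) (by rw [u.2, v.2]; exact huv.2.1) (by
        intro k _ h1 h2 h3
        rw [u.2] at h3
        by_contra! hne
        refine huv.2.2 ⟨ρ k, h.idem k⟩ ?_ ?_ h3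
        · exact Subtype.coe_lt_coe.1
            ((u.2.symm.le.trans (h.mono h1.le)).lt_of_ne (u.2.symm.trans_ne hne.1.symm))
        · exact Subtype.coe_lt_coe.1
            (((h.mono h2.le).trans v.2.le).lt_of_ne (hne.2.trans_eq v.2)))
    rw [u.2, v.2] at hs
    obtain ⟨s, hs, hsw⟩ := hs
    exact ⟨⟨s, h.usefulGens_subset hs⟩, hs, h.blockPerm_eq_swap _ hsw⟩

theorem thetaLE_iff (h : IsBlockStart ρ Θ) (x y : stabGroup Θ) :
    thetaLE Θ x y ↔ BruhatLE (adjSwaps (blockSize ρ)) (h.blockPerm x) (h.blockPerm y) := by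
  rw [← h.image_usefulGens, bruhatLE_image h.blockPerm_injective,
    ← bruhatLE_image (f := (stabGroup Θ).subtype) Subtype.coe_injective]
  have : (stabGroup Θ).subtype '' {s | s.1 ∈ usefulGens (posRoots n) Θ} =
      usefulGens (posRoots n) Θ := by
    ext s
    exact ⟨fun ⟨s, hs, he⟩ => he ▸ hs, fun hs => ⟨⟨s, h.usefulGens_subset hs⟩, hs, rfl⟩⟩
  rw [this]
  rfl

/-- Every permutation of the blocks that preserves sizes comes from the stabilizer. -/
theorem exists_blockPerm_eq (h : IsBlockStart ρ Θ) {x : Perm {i // ρ i = i}}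
    (hx : x ∈ colorPerms (blockSize ρ)) : ∃ w, h.blockPerm w = x := by
  rw [← closure_adjSwaps, ← h.image_usefulGens, ← MonoidHom.map_closure] at hx
  obtain ⟨w, -, hw⟩ := hx
  exact ⟨w, hw⟩

end IsBlockStart

end Stabilizer

/-! ### The group `W[Θ₀]` -/

section Bracket

open Equiv

variable {n : ℕ} {Θ : Set (Fin n → ℂ)}

/-- The indices at which all the roots in `Θ₀` vanish. -/
def freeSet (Θ : Set (Fin n → ℂ)) : Set (Fin n) := {i | ∀ θ ∈ theta0 Θ, θ i = 0}

open scoped Classical in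
/-- The colouring with the class `freeSet Θ`, the other classes being singletons. -/
noncomputable def freeColor (Θ : Set (Fin n → ℂ)) (i : Fin n) : Option (Fin n) :=
  if i ∈ freeSet Θ then none else some i

theorem freeColor_eq_none {i : Fin n} : freeColor Θ i = none ↔ i ∈ freeSet Θ := by
  simp [freeColor]

theorem freeColor_eq_iff {i j : Fin n} :
    freeColor Θ i = freeColor Θ j ↔ i = j ∨ (i ∈ freeSet Θ ∧ j ∈ freeSet Θ) := by
  unfold freeColor
  grind

theorem apply_eq_of_notMem {x : Perm (Fin n)} (hx : x ∈ colorPerms (freeColor Θ)) {i : Fin n}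
    (hi : i ∉ freeSet Θ) : x i = i := by
  rcases freeColor_eq_iff.1 (hx i) with h | h
  · exact h
  · exact absurd h.2 hi

theorem phiPos_eq (hΘ : Θ ⊆ simpleRoots n) :
    phiPos Θ = rootsOf fun i j => i < j ∧ i ∈ freeSet Θ ∧ j ∈ freeSet Θ := by
  rw [simpleRoots_eq] at hΘ
  ext β
  constructor
  · rintro ⟨⟨i, j, hij, rfl⟩, h⟩
    have heq : ∀ θ ∈ theta0 Θ, θ i = θ j := fun θ hθ => by
      have := h θ hθ
      rwa [sub_dotProduct_e, sub_eq_zero] at this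
    -- a root takes each of its nonzero values only once
    have hz : ∀ θ ∈ theta0 Θ, θ i = 0 := fun θ hθ => by
      have h1 := heq θ hθ
      obtain ⟨a, b, -, rfl⟩ := hΘ hθ.1
      simp only [Pi.sub_apply, e_apply] at h1 ⊢
      by_contra hne
      split_ifs at h1 hne <;> try norm_num at h1
      all_goals exact hij.ne (by simp_all)
    exact ⟨i, j, ⟨hij, hz, fun θ hθ => (heq θ hθ).symm.trans (hz θ hθ)⟩, rfl⟩
  · rintro ⟨i, j, ⟨hij, hi, hj⟩, rfl⟩
    refine ⟨⟨i, j, hij, rfl⟩, fun θ hθ => ?_⟩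
    rw [sub_dotProduct_e, hi θ hθ, hj θ hθ, sub_self]

theorem simples_phiPos (hΘ : Θ ⊆ simpleRoots n) :
    simples (phiPos Θ) = rootsOf (Consec (freeColor Θ)) := by
  rw [phiPos_eq hΘ, ← simples_rootsOf_color]
  congr 2
  ext i j
  refine and_congr_right fun hij => ?_
  rw [freeColor_eq_iff, or_iff_right hij.ne]

theorem bracketGens_eq (hΘ : Θ ⊆ simpleRoots n) : bracketGens Θ = adjSwaps (freeColor Θ) := by
  rw [bracketGens, simples_phiPos hΘ, reflections_consec]

theorem bracketWeyl_eq (hΘ : Θ ⊆ simpleRoots n) : bracketWeyl Θ = colorPerms (freeColor Θ) := by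
  rw [bracketWeyl, bracketGens_eq hΘ, closure_adjSwaps]

theorem weylLE_iff {x y : Perm (Fin n)} :
    weylLE x y ↔ BruhatLE (adjSwaps fun _ : Fin n => ()) x y := by
  rw [weylLE, simpleRoots_eq, reflections_consec]

open scoped Classical in
/-- The places outside `freeSet Θ` contribute a number to `exceed` that does not depend
on `x`. -/
theorem exceed_mul_eq {x : Perm (Fin n)} (hx : x ∈ colorPerms (freeColor Θ)) (w : Perm (Fin n))
    (p q : Fin n) :
    exceed (fun _ => ()) (x * w) () p q =
      (Finset.univ.filter fun b => b ∈ freeSet Θ ∧ w⁻¹ b ≤ p ∧ q < x b).card +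
        (Finset.univ.filter fun b => b ∉ freeSet Θ ∧ w⁻¹ b ≤ p ∧ q < b).card := by
  have h1 : exceed (fun _ => ()) (x * w) () p q =
      (Finset.univ.filter fun b => w⁻¹ b ≤ p ∧ q < x b).card := by
    refine Finset.card_equiv w fun a => ?_
    simp
  rw [h1, ← Finset.card_filter_add_card_filter_not (fun b => b ∈ freeSet Θ)]
  congr 2
  · ext b
    simp only [Finset.mem_filter, Finset.mem_univ, true_and]
    tauto
  · ext b
    simp only [Finset.mem_filter, Finset.mem_univ, true_and]
    constructor
    · rintro ⟨⟨h2, h3⟩, h4⟩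
      rw [apply_eq_of_notMem hx h4] at h3
      exact ⟨h4, h2, h3⟩
    · rintro ⟨h2, h3, h4⟩
      rw [apply_eq_of_notMem hx h2]
      exact ⟨⟨h3, h4⟩, h2⟩

/-- The Bruhat ordering of `W` on the coset `W[Θ₀] w` is that of `W[Θ₀]`, if `w⁻¹` preserves the
order of the indices that `W[Θ₀]` permutes. -/
theorem weylLE_mul_iff {x y w : Perm (Fin n)} (hx : x ∈ colorPerms (freeColor Θ))
    (hy : y ∈ colorPerms (freeColor Θ))
    (hw : ∀ i ∈ freeSet Θ, ∀ j ∈ freeSet Θ, i < j → w⁻¹ i < w⁻¹ j) :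
    weylLE (x * w) (y * w) ↔ BruhatLE (adjSwaps (freeColor Θ)) x y := by
  classical
  have hw' : ∀ i ∈ freeSet Θ, ∀ j ∈ freeSet Θ, w⁻¹ i ≤ w⁻¹ j ↔ i ≤ j := fun i hi j hj => by
    constructor
    · intro h
      by_contra hlt
      exact not_lt.2 h (hw j hj i hi (not_le.1 hlt))
    · intro h
      rcases h.eq_or_lt with rfl | h
      · rfl
      · exact (hw i hi j hj h).le
  have hset : ∀ z p q, p ∈ freeSet Θ → exceed (freeColor Θ) z none p q =
      (Finset.univ.filter fun b => b ∈ freeSet Θ ∧ w⁻¹ b ≤ w⁻¹ p ∧ q < z b).card := by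
    intro z p q hp
    unfold exceed
    congr 1
    ext b
    simp only [Finset.mem_filter, Finset.mem_univ, true_and, freeColor_eq_none]
    constructor
    · rintro ⟨h1, h2, h3⟩
      exact ⟨h2, (hw' b h2 p hp).2 h1, h3⟩
    · rintro ⟨h1, h2, h3⟩
      exact ⟨(hw' b h1 p hp).1 h2, h1, h3⟩
  rw [weylLE_iff]
  constructor
  · refine fun h => bruhatLE_of_exceed_le hx hy fun p q hpq => ?_
    by_cases hp : p ∈ freeSet Θ
    · have := exceed_le_of_bruhatLE h () (w⁻¹ p) q
      rw [exceed_mul_eq hx, exceed_mul_eq hy] at this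
      rw [freeColor_eq_none.2 hp, hset _ _ _ hp, hset _ _ _ hp]
      lia
    · -- the class of `p` is a singleton
      have hz : exceed (freeColor Θ) x (freeColor Θ p) p q = 0 := by
        rw [exceed, Finset.card_eq_zero]
        ext a
        simp only [Finset.mem_filter, Finset.mem_univ, true_and, Finset.notMem_empty, iff_false]
        rintro ⟨-, h2, h3⟩
        obtain rfl : a = p := (freeColor_eq_iff.1 h2).resolve_right fun h => hp h.2
        obtain rfl : a = q := (freeColor_eq_iff.1 hpq).resolve_right fun h => hp h.1
        rw [apply_eq_of_notMem hx hp] at h3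
        exact lt_irrefl _ h3
      rw [hz]
      exact Nat.zero_le _
  · refine fun h => bruhatLE_of_exceed_le (fun _ => rfl) (fun _ => rfl) fun p q _ => ?_
    rw [exceed_mul_eq hx, exceed_mul_eq hy]
    refine Nat.add_le_add_right ?_ _
    rcases Set.eq_empty_or_nonempty {b | b ∈ freeSet Θ ∧ w⁻¹ b ≤ p} with hemp | hne
    · have hz : (Finset.univ.filter fun b => b ∈ freeSet Θ ∧ w⁻¹ b ≤ p ∧ q < x b) = ∅ := by
        ext b
        simp only [Finset.mem_filter, Finset.mem_univ, true_and, Finset.notMem_empty, iff_false]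
        rintro ⟨h1, h2, -⟩
        have : b ∈ {b | b ∈ freeSet Θ ∧ w⁻¹ b ≤ p} := ⟨h1, h2⟩
        rwa [hemp] at this
      rw [hz, Finset.card_empty]
      exact Nat.zero_le _
    · obtain ⟨p', ⟨hp', hpp'⟩, hmax⟩ := Set.exists_max_image _ id (Set.toFinite _) hne
      have hset' : ∀ z : Perm (Fin n),
          (Finset.univ.filter fun b => b ∈ freeSet Θ ∧ w⁻¹ b ≤ p ∧ q < z b) =
          (Finset.univ.filter fun b => b ∈ freeSet Θ ∧ w⁻¹ b ≤ w⁻¹ p' ∧ q < z b) := by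
        intro z
        ext b
        simp only [Finset.mem_filter, Finset.mem_univ, true_and]
        refine and_congr_right fun hb => and_congr_left fun _ => ?_
        exact ⟨fun h => (hw' b hb p' hp').2 (hmax b ⟨hb, h⟩), fun h => h.trans hpp'⟩
      rw [hset', hset', ← hset _ _ _ hp', ← hset _ _ _ hp']
      exact exceed_le_of_bruhatLE h _ _ _

end Bracket

/-! ### Block permutations and the Bruhat ordering -/

section Main

open Equiv

variable {n : ℕ} {Θ : Set (Fin n → ℂ)} {ρ : Fin n → Fin n}

/-- The colouring by the blocks of `Θ₁`: the blocks within `freeSet Θ`, represented by their first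
elements, and singletons outside. -/
noncomputable def freeBlock (Θ : Set (Fin n → ℂ)) (ρ : Fin n → Fin n) (i : Fin n) : Fin n :=
  open scoped Classical in if i ∈ freeSet Θ then ρ i else i

namespace IsBlockStart

variable {i j : Fin n}

theorem apply_eq_of_notMem_freeSet (h : IsBlockStart ρ Θ) (hi : i ∉ freeSet Θ) {w : Perm (Fin n)}
    (hw : w ∈ stabGroup Θ) : w i = i := by
  simp only [freeSet, Set.mem_ofPred_eq, not_forall] at hi
  obtain ⟨θ, hθ, hne⟩ := hi
  have hmem := hθ.1
  rw [h.theta_eq] at hmem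
  obtain ⟨a, b, hab, rfl⟩ := hmem
  have hfix := hθ.2 w hw
  rw [act_root] at hfix
  obtain ⟨ha, hb⟩ := root_injective (w.injective.ne hab.1.ne) hfix
  simp only [Pi.sub_apply, e_apply] at hne
  by_cases h1 : i = a
  · rw [h1, ha]
  · by_cases h2 : i = b
    · rw [h2, hb]
    · simp [h1, h2] at hne

theorem mem_freeSet_iff_of_consec (h : IsBlockStart ρ Θ) (hij : Consec ρ i j) :
    i ∈ freeSet Θ ↔ j ∈ freeSet Θ := by
  have hmem : e i - e j ∈ Θ := by
    rw [h.theta_eq]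
    exact ⟨i, j, hij, rfl⟩
  -- if one of the two indices is fixed by the stabilizer, then the root lies in `Θ₀`
  have key : (∀ w ∈ stab Θ, w i = i ∧ w j = j) → i ∉ freeSet Θ ∧ j ∉ freeSet Θ := fun hw => by
    have h0 : e i - e j ∈ theta0 Θ :=
      ⟨hmem, fun w hw' => by rw [act_root, (hw w hw').1, (hw w hw').2]⟩
    refine ⟨fun hi => ?_, fun hj => ?_⟩
    · have := hi _ h0
      simp [e_apply, hij.1.ne] at this
    · have := hj _ h0
      simp [e_apply, hij.1.ne'] at this
  constructor
  · intro hi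
    by_contra hj
    refine (key fun w hw => ?_).1 hi
    have := h.apply_eq_of_notMem_freeSet hj hw
    exact ⟨(h.apply_eq_self_iff hw hij).2 this, this⟩
  · intro hj
    by_contra hi
    refine (key fun w hw => ?_).2 hj
    have := h.apply_eq_of_notMem_freeSet hi hw
    exact ⟨this, (h.apply_eq_self_iff hw hij).1 this⟩

/-- `freeSet Θ` is a union of blocks. -/
theorem mem_freeSet_iff (h : IsBlockStart ρ Θ) (hij : ρ i = ρ j) :
    i ∈ freeSet Θ ↔ j ∈ freeSet Θ := by
  have key : ∀ i j, i < j → ρ i = ρ j → (i ∈ freeSet Θ ↔ j ∈ freeSet Θ) := fun i j hij hc =>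
    rel_of_consec (Q := fun i j => i ∈ freeSet Θ ↔ j ∈ freeSet Θ) (fun _ _ _ => Iff.trans)
      (fun _ _ => h.mem_freeSet_iff_of_consec) hij hc
  rcases lt_trichotomy i j with h1 | rfl | h1
  · exact key i j h1 hij
  · rfl
  · exact (key j i h1 hij.symm).symm

theorem start_mem_freeSet (h : IsBlockStart ρ Θ) : ρ i ∈ freeSet Θ ↔ i ∈ freeSet Θ :=
  h.mem_freeSet_iff (h.idem i)

theorem stabGroup_le (h : IsBlockStart ρ Θ) : stabGroup Θ ≤ colorPerms (freeColor Θ) := by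
  intro w hw i
  rw [freeColor_eq_iff]
  by_cases hi : i ∈ freeSet Θ
  · refine Or.inr ⟨?_, hi⟩
    by_contra hwi
    have := w.injective (h.apply_eq_of_notMem_freeSet hwi hw)
    rw [this] at hwi
    exact hwi hi
  · exact Or.inl (h.apply_eq_of_notMem_freeSet hi hw)

theorem apply_mem_freeSet (h : IsBlockStart ρ Θ) {w : Perm (Fin n)} (hw : w ∈ stabGroup Θ) :
    w i ∈ freeSet Θ ↔ i ∈ freeSet Θ := by
  rw [← freeColor_eq_none, ← freeColor_eq_none, h.stabGroup_le hw]

theorem freeBlock_of_mem (hi : i ∈ freeSet Θ) : freeBlock Θ ρ i = ρ i := if_pos hi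

theorem freeBlock_of_notMem (hi : i ∉ freeSet Θ) : freeBlock Θ ρ i = i := if_neg hi

theorem freeBlock_eq (h : IsBlockStart ρ Θ) (hij : freeBlock Θ ρ i = freeBlock Θ ρ j) :
    i = j ∨ (i ∈ freeSet Θ ∧ j ∈ freeSet Θ) := by
  by_cases hi : i ∈ freeSet Θ <;> by_cases hj : j ∈ freeSet Θ
  · exact Or.inr ⟨hi, hj⟩
  · rw [freeBlock_of_mem hi, freeBlock_of_notMem hj] at hij
    rw [← hij, h.start_mem_freeSet] at hj
    exact absurd hi hj
  · rw [freeBlock_of_notMem hi, freeBlock_of_mem hj] at hij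
    rw [hij, h.start_mem_freeSet] at hi
    exact absurd hj hi
  · rw [freeBlock_of_notMem hi, freeBlock_of_notMem hj] at hij
    exact Or.inl hij

theorem isBlocks_free (h : IsBlockStart ρ Θ) (hΘ : Θ ⊆ simpleRoots n) :
    IsBlocks (freeSet Θ) (freeBlock Θ ρ) (phiPos Θ) (theta1 Θ) where
  mono i hi j hj hij := by
    rw [freeBlock_of_mem hi, freeBlock_of_mem hj]
    exact h.mono hij
  outside _ _ := h.freeBlock_eq
  pos_eq := phiPos_eq hΘ
  theta_eq := by
    ext α
    constructor
    · rintro ⟨hα, h0⟩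
      have hα' := hα
      rw [h.theta_eq] at hα'
      obtain ⟨i, j, hij, rfl⟩ := hα'
      have hi : i ∈ freeSet Θ := by
        by_contra hi
        refine h0 ⟨hα, fun w hw => ?_⟩
        have := h.apply_eq_of_notMem_freeSet hi hw
        rw [act_root, this, (h.apply_eq_self_iff hw hij).1 this]
      have hj := (h.mem_freeSet_iff hij.2.1).1 hi
      refine ⟨i, j, ⟨hij.1, ?_, fun k h1 h2 => absurd h2 (h.not_lt_of_consec hij h1)⟩, rfl⟩
      rw [freeBlock_of_mem hi, freeBlock_of_mem hj, hij.2.1]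
    · rintro ⟨i, j, hij, rfl⟩
      obtain ⟨hi, hj⟩ := (h.freeBlock_eq hij.2.1).resolve_left hij.1.ne
      have hc := hij.2.1
      rw [freeBlock_of_mem hi, freeBlock_of_mem hj] at hc
      refine ⟨?_, fun h0 => ?_⟩
      · rw [h.theta_eq]
        refine ⟨i, j, ⟨hij.1, hc, fun k h1 h2 h3 => hij.2.2 k h1 h2 ?_⟩, rfl⟩
        rw [freeBlock_of_mem hi, freeBlock_of_mem ((h.mem_freeSet_iff h3).2 hi), h3]
      · have := hi _ h0
        simp [e_apply, hij.1.ne] at this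

theorem classSize_freeBlock (h : IsBlockStart ρ Θ) {a : Fin n} (ha : a ∈ freeSet Θ)
    (ha' : ρ a = a) : classSize (freeBlock Θ ρ) a = classSize ρ a := by
  unfold classSize
  congr 1
  ext k
  simp only [Finset.mem_filter, Finset.mem_univ, true_and]
  by_cases hk : k ∈ freeSet Θ
  · rw [freeBlock_of_mem hk]
  · rw [freeBlock_of_notMem hk]
    constructor
    · rintro rfl
      exact ha'
    · intro hka
      exact absurd ((h.mem_freeSet_iff (hka.trans ha'.symm)).2 ha) hk

/-- Blocks of the same size are exchanged by the stabilizer. -/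
theorem exists_apply_eq (h : IsBlockStart ρ Θ) {u v : {i // ρ i = i}}
    (huv : blockSize ρ u = blockSize ρ v) : ∃ w ∈ stabGroup Θ, w u = v := by
  obtain ⟨w, hw⟩ := h.exists_blockPerm_eq (swap_mem_colorPerms huv)
  refine ⟨w.1, w.2, ?_⟩
  rw [← h.coe_blockPerm, hw, swap_apply_left]

/-- For an almost seminormal `Θ`, no other block in `freeSet Θ` lies between two consecutive blocks
of the same size in `freeSet Θ`. -/
theorem not_between_of_consec (h : IsBlockStart ρ Θ) (hΘ : Θ ⊆ simpleRoots n)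
    (hsn : IsAlmostSeminormal Θ) {u v k : {i // ρ i = i}} (huv : Consec (blockSize ρ) u v)
    (hu : (u : Fin n) ∈ freeSet Θ) (hk : (k : Fin n) ∈ freeSet Θ) (huk : u < k) : ¬ k < v := by
  intro hkv
  have hb := h.isBlocks_free hΘ
  have hv : (v : Fin n) ∈ freeSet Θ := by
    obtain ⟨w, hw, hwu⟩ := h.exists_apply_eq huv.2.1
    rw [← hwu, h.apply_mem_freeSet hw]
    exact hu
  have hlt : (u : Fin n) < v := huv.1
  have hcu : freeBlock Θ ρ u = u := by rw [freeBlock_of_mem hu, u.2]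
  have hcv : freeBlock Θ ρ v = v := by rw [freeBlock_of_mem hv, v.2]
  obtain ⟨Ψ, -, hΨ, heq⟩ := hsn
  have hsimple := (hb.mem_usefulSimple hu hv hlt (by rw [hcu, hcv]; exact hlt.ne) (by
    rw [hcu, hcv, h.classSize_freeBlock hu u.2, h.classSize_freeBlock hv v.2]
    exact huv.2.1)).2 (by
      intro m hm h1 h2 h3
      rw [hcu, freeBlock_of_mem hm, h.classSize_freeBlock hu u.2,
        h.classSize_freeBlock (h.start_mem_freeSet.2 hm) (h.idem m)] at h3
      rw [hcu, hcv, freeBlock_of_mem hm]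
      by_contra! hne
      refine huv.2.2 ⟨ρ m, h.idem m⟩ ?_ ?_ h3
      · exact Subtype.coe_lt_coe.1 ((u.2.symm.le.trans (h.mono h1.le)).lt_of_ne hne.1.symm)
      · exact Subtype.coe_lt_coe.1 (((h.mono h2.le).trans v.2.le).lt_of_ne hne.2))
  rw [heq] at hsimple
  obtain ⟨β, ⟨hβ, -⟩, hr⟩ := hsimple
  have hβ := hΨ hβ
  rw [simples_phiPos hΘ] at hβ
  obtain ⟨a, b, hab, rfl⟩ := hβ
  obtain ⟨ha, hb'⟩ := (freeColor_eq_iff.1 hab.2.1).resolve_left hab.1.ne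
  have he : e (u : Fin n) - e (v : Fin n) = e (ρ a) - e (ρ b) := by
    funext m
    obtain ⟨H, hH⟩ := hb.exists_indicator m
    have h1 := hH u v
    rw [hcu, hcv] at h1
    rw [← h1, ← hr, hH, freeBlock_of_mem ha, freeBlock_of_mem hb']
  obtain ⟨hua, hvb⟩ := root_injective hlt.ne he
  refine hab.2.2 k (h.mono.reflect_lt ?_) (lt_of_lt_of_le ?_ (h.le b)) ?_
  · rw [← hua, k.2]
    exact huk
  · rw [← hvb]
    exact hkv
  · rw [freeColor_eq_none.2 hk, freeColor_eq_none.2 ha]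

/-- For an almost seminormal `Θ`, the blocks of a given size are contiguous within
`freeSet Θ`. -/
theorem blockSize_eq_of_between (h : IsBlockStart ρ Θ) (hΘ : Θ ⊆ simpleRoots n)
    (hsn : IsAlmostSeminormal Θ) {u v k : {i // ρ i = i}} (huv : blockSize ρ u = blockSize ρ v)
    (hu : (u : Fin n) ∈ freeSet Θ) (hk : (k : Fin n) ∈ freeSet Θ) (huk : u < k) (hkv : k < v) :
    blockSize ρ k = blockSize ρ u := by
  refine (rel_of_consec (c := blockSize ρ) (Q := fun u v => blockSize ρ u = blockSize ρ v ∧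
    ((u : Fin n) ∈ freeSet Θ → (v : Fin n) ∈ freeSet Θ ∧ ∀ k : {i // ρ i = i},
      (k : Fin n) ∈ freeSet Θ → u < k → k < v → blockSize ρ k = blockSize ρ u)) ?_ ?_
    (huk.trans hkv) huv).2 hu |>.2 k hk huk hkv
  · rintro a b c ⟨h1, h2⟩ ⟨h3, h4⟩
    refine ⟨h1.trans h3, fun ha => ?_⟩
    obtain ⟨hb, h5⟩ := h2 ha
    obtain ⟨hc, h6⟩ := h4 hb
    refine ⟨hc, fun k hk hak hkc => ?_⟩
    rcases lt_trichotomy k b with h7 | rfl | h7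
    · exact h5 k hk hak h7
    · exact h1.symm
    · exact (h6 k hk h7 hkc).trans h1.symm
  · intro a b hab
    refine ⟨hab.2.1, fun ha => ⟨?_, fun k hk hak hkb => ?_⟩⟩
    · obtain ⟨w, hw, hwu⟩ := h.exists_apply_eq hab.2.1
      rw [← hwu, h.apply_mem_freeSet hw]
      exact ha
    · exact absurd hkb (h.not_between_of_consec hΘ hsn hab ha hk hak)

/-- The tableau condition for the indices at the ends of two blocks of the same size counts whole
blocks, which all have this size. -/
theorem exceed_eq_mul (h : IsBlockStart ρ Θ) (hΘ : Θ ⊆ simpleRoots n)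
    (hsn : IsAlmostSeminormal Θ) {u v : {i // ρ i = i}} (huv : blockSize ρ u = blockSize ρ v)
    (hu : (u : Fin n) ∈ freeSet Θ) (hv : (v : Fin n) ∈ freeSet Θ) {p q : Fin n} (hp : ρ p = u)
    (hp' : ∀ l, ρ l = u → l ≤ p) (hq : ρ q = v) (hq' : ∀ l, ρ l = v → l ≤ q) (x : stabGroup Θ) :
    exceed (freeColor Θ) x.1 none p q =
      exceed (blockSize ρ) (h.blockPerm x) (blockSize ρ u) u v * blockSize ρ u := by
  classical
  have hle : ∀ a, a ≤ p ↔ ρ a ≤ u := fun a => by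
    constructor
    · intro ha
      rw [← hp]
      exact h.mono ha
    · intro ha
      rcases ha.eq_or_lt with ha | ha
      · exact hp' a ha
      · exact (h.mono.reflect_lt (hp ▸ ha)).le
  have hlt : ∀ a, q < a ↔ v < ρ a := fun a => by
    constructor
    · intro ha
      refine (hq ▸ h.mono ha.le).lt_of_ne fun heq => ?_
      exact not_le.2 ha (hq' a heq.symm)
    · intro ha
      exact h.mono.reflect_lt (hq ▸ ha)
  have hsize : ∀ b : {i // ρ i = i}, (b : Fin n) ∈ freeSet Θ → b ≤ u → v < h.blockPerm x b →
      blockSize ρ b = blockSize ρ u := by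
    intro b hb hbu hvb
    have hs : blockSize ρ (h.blockPerm x b) = blockSize ρ b := h.blockPerm_mem_colorPerms x b
    have hxb : (h.blockPerm x b : Fin n) ∈ freeSet Θ := by
      rw [h.coe_blockPerm, h.apply_mem_freeSet x.2]
      exact hb
    have hbtw := fun {u v k : {i // ρ i = i}} huv hu hk huk hkv =>
      h.blockSize_eq_of_between hΘ hsn (u := u) (v := v) (k := k) huv hu hk huk hkv
    rcases hbu.eq_or_lt with rfl | hbu
    · rfl
    · rcases lt_trichotomy u (h.blockPerm x b) with h1 | h1 | h1
      · exact (hbtw hs.symm hb hu hbu h1).symm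
      · rw [← hs, ← h1]
      · rw [← hs, huv]
        exact hbtw huv.symm hv hxb hvb h1
  have hmaps : Set.MapsTo ρ
      ↑(Finset.univ.filter fun a => a ≤ p ∧ freeColor Θ a = none ∧ q < x.1 a)
      ↑((Finset.univ.filter fun b : {i // ρ i = i} => b ≤ u ∧ blockSize ρ b = blockSize ρ u ∧
        v < h.blockPerm x b).map (Function.Embedding.subtype _)) := by
    intro a ha
    simp only [Finset.coe_filter, Finset.mem_univ, true_and, Set.mem_ofPred_eq,
      freeColor_eq_none] at ha
    obtain ⟨h1, h2, h3⟩ := ha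
    rw [hlt, h.apply_start x.2] at h3
    rw [hle] at h1
    refine Finset.mem_coe.2 (Finset.mem_map.2 ⟨⟨ρ a, h.idem a⟩, ?_, rfl⟩)
    simp only [Finset.mem_filter, Finset.mem_univ, true_and]
    exact ⟨h1, hsize _ (h.start_mem_freeSet.2 h2) h1 h3, h3⟩
  have hcard := Finset.card_eq_sum_card_fiberwise hmaps
  rw [Finset.sum_map, Finset.sum_const_nat (m := blockSize ρ u)] at hcard
  · unfold exceed
    convert hcard
  intro b hb
  simp only [Finset.mem_filter, Finset.mem_univ, true_and] at hb
  obtain ⟨h1, h2, h3⟩ := hb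
  have hbE : (b : Fin n) ∈ freeSet Θ := by
    obtain ⟨w, hw, hwb⟩ := h.exists_apply_eq h2
    rw [← h.apply_mem_freeSet hw, hwb]
    exact hu
  rw [← h2]
  unfold blockSize classSize
  congr 1
  ext a
  simp only [Finset.mem_filter, Finset.mem_univ, true_and, Function.Embedding.subtype_apply,
    freeColor_eq_none]
  refine ⟨fun ha => ha.2, fun ha => ⟨⟨?_, ?_, ?_⟩, ha⟩⟩
  · rw [hle, ha]
    exact h1
  · rw [← h.start_mem_freeSet, ha]
    exact hbE
  · rw [hlt, h.apply_start x.2, ha]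
    exact h3

/-- Relations in the Bruhat ordering of the block permutations hold in that of `W[Θ₀]`, because
each upward exchange of two blocks increases all the numbers `exceed`. -/
theorem bruhatLE_of_blockPerm (h : IsBlockStart ρ Θ) {x y : stabGroup Θ}
    (hxy : BruhatLE (adjSwaps (blockSize ρ)) (h.blockPerm x) (h.blockPerm y)) :
    BruhatLE (adjSwaps (freeColor Θ)) x.1 y.1 := by
  suffices H : ∃ z, h.blockPerm z = h.blockPerm y ∧
      ∀ k p q, exceed (freeColor Θ) x.1 k p q ≤ exceed (freeColor Θ) z.1 k p q by
    obtain ⟨z, hz, hle⟩ := H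
    rw [← h.blockPerm_injective hz]
    exact bruhatLE_of_exceed_le (h.stabGroup_le x.2) (h.stabGroup_le z.2) fun p q _ => hle _ p q
  obtain ⟨-, -, hxy⟩ := hxy
  generalize h.blockPerm y = Y at hxy
  induction hxy with
  | refl => exact ⟨x, rfl, fun _ _ _ => le_rfl⟩
  | tail _ hstep ih =>
    obtain ⟨z, rfl, hle⟩ := ih
    obtain ⟨u, v, huv, hc, hlt, rfl⟩ :=
      (bruhatStep_adjSwaps (h.blockPerm_mem_colorPerms z)).1 hstep
    obtain ⟨t, ht⟩ := h.exists_blockPerm_eq (swap_mem_colorPerms hc)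
    have htt : t * t = 1 := h.blockPerm_injective (by rw [map_mul, ht, swap_mul_self, map_one])
    have htt' : ∀ a, t.1 (t.1 a) = a := fun a => by
      have := congrArg Subtype.val htt
      exact DFunLike.congr_fun this a
    refine ⟨z * t, by rw [map_mul, ht]; congr!, fun k p q => (hle k p q).trans ?_⟩
    refine exceed_le_mul (h.stabGroup_le t.2) (congrArg Subtype.val htt) (fun a ha => ?_) k p q
    -- an index that `t` moves to the right lies in the block of `u`
    have hρ : ρ a < ρ (t.1 a) := by
      refine (h.mono ha.le).lt_of_ne fun heq => ?_
      have := h.apply_lt t.2 ha heq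
      rw [htt'] at this
      exact lt_asymm ha this
    have hta : ρ (t.1 a) = (swap u v ⟨ρ a, h.idem a⟩ : {i // ρ i = i}) := by
      rw [h.apply_start t.2, ← ht, h.coe_blockPerm]
    have hau : ρ a = u := by
      rw [hta, swap_apply_def] at hρ
      split_ifs at hρ with h1 h2
      · exact congrArg Subtype.val h1
      · have hav : ρ a = v := congrArg Subtype.val h2
        rw [hav] at hρ
        exact absurd (Subtype.coe_lt_coe.1 hρ) (lt_asymm huv)
      · exact absurd hρ (lt_irrefl _)
    refine h.mono.reflect_lt ?_
    have hau' : (⟨ρ a, h.idem a⟩ : {i // ρ i = i}) = u := Subtype.ext hau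
    rw [h.apply_start z.2, h.apply_start z.2, hta, hau', hau, swap_apply_left]
    exact hlt

/-- The converse of `bruhatLE_of_blockPerm`, by `exceed_eq_mul`. -/
theorem blockPerm_bruhatLE (h : IsBlockStart ρ Θ) (hΘ : Θ ⊆ simpleRoots n)
    (hsn : IsAlmostSeminormal Θ) {x y : stabGroup Θ}
    (hxy : BruhatLE (adjSwaps (freeColor Θ)) x.1 y.1) :
    BruhatLE (adjSwaps (blockSize ρ)) (h.blockPerm x) (h.blockPerm y) := by
  refine bruhatLE_of_exceed_le (h.blockPerm_mem_colorPerms x) (h.blockPerm_mem_colorPerms y)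
    fun u v huv => ?_
  have htrans : ∀ a b : {i // ρ i = i}, blockSize ρ a = blockSize ρ b →
      (b : Fin n) ∉ freeSet Θ → a = b := fun a b hab hb => by
    obtain ⟨w, hw, hwb⟩ := h.exists_apply_eq hab.symm
    rw [h.apply_eq_of_notMem_freeSet hb hw] at hwb
    exact Subtype.ext hwb.symm
  by_cases hu : (u : Fin n) ∈ freeSet Θ
  · have hv : (v : Fin n) ∈ freeSet Θ := by
      by_contra hv
      rw [htrans u v huv hv] at hu
      exact hv hu
    obtain ⟨p, hp, hp'⟩ := exists_last ρ u
    obtain ⟨q, hq, hq'⟩ := exists_last ρ v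
    rw [u.2] at hp hp'
    rw [v.2] at hq hq'
    have hle := exceed_le_of_bruhatLE hxy none p q
    rw [h.exceed_eq_mul hΘ hsn huv hu hv hp hp' hq hq',
      h.exceed_eq_mul hΘ hsn huv hu hv hp hp' hq hq'] at hle
    have hpos : 0 < classSize ρ u := Finset.card_pos.2 ⟨u, by simpa using u.2⟩
    exact Nat.le_of_mul_le_mul_right hle hpos
  · -- the block `u` is the only one of its size, and it is fixed
    have hz : exceed (blockSize ρ) (h.blockPerm x) (blockSize ρ u) u v = 0 := by
      rw [exceed, Finset.card_eq_zero]
      ext a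
      simp only [Finset.mem_filter, Finset.mem_univ, true_and, Finset.notMem_empty, iff_false]
      rintro ⟨-, h2, h3⟩
      obtain rfl := htrans a u h2 hu
      obtain rfl := htrans v a huv.symm hu
      rw [htrans _ v (h.blockPerm_mem_colorPerms x v) hu] at h3
      exact lt_irrefl _ h3
    rw [hz]
    exact Nat.zero_le _

end IsBlockStart

end Main

end TypeA

theorem corollary7p3p4 (n : ℕ) (Θ : Set (Fin n → ℂ)) (hΘ : Θ ⊂ TypeA.simpleRoots n)
    (w : Equiv.Perm (Fin n))
    (hw : ∀ β ∈ TypeA.phiPos Θ, TypeA.act w⁻¹ β ∈ TypeA.posRoots n) :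
    (∀ x ∈ TypeA.bracketWeyl Θ, ∀ y ∈ TypeA.bracketWeyl Θ,
      TypeA.weylLE (x * w) (y * w) ↔ TypeA.bracketLE Θ x y) ∧
    (TypeA.IsAlmostSeminormal Θ →
      ∀ x ∈ TypeA.stab Θ, ∀ y ∈ TypeA.stab Θ,
        TypeA.weylLE (x * w) (y * w) ↔ TypeA.thetaLE Θ x y) := by
  have hw' : ∀ i ∈ TypeA.freeSet Θ, ∀ j ∈ TypeA.freeSet Θ, i < j → w⁻¹ i < w⁻¹ j := by
    intro i hi j hj hij
    have := hw (TypeA.e i - TypeA.e j) (by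
      rw [TypeA.phiPos_eq hΘ.subset]
      exact ⟨i, j, ⟨hij, hi, hj⟩, rfl⟩)
    rwa [TypeA.act_root, TypeA.posRoots_eq,
      TypeA.mem_rootsOf (w⁻¹.injective.ne hij.ne)] at this
  refine ⟨fun x hx y hy => ?_, fun hsn x hx y hy => ?_⟩
  · rw [TypeA.bracketWeyl_eq hΘ.subset] at hx hy
    rw [TypeA.weylLE_mul_iff hx hy hw', TypeA.bracketLE, TypeA.bracketGens_eq hΘ.subset]
  · obtain ⟨ρ, h⟩ := TypeA.exists_blockStart hΘ.subset
    rw [TypeA.weylLE_mul_iff (h.stabGroup_le hx) (h.stabGroup_le hy) hw',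
      h.thetaLE_iff ⟨x, hx⟩ ⟨y, hy⟩]
    exact ⟨h.blockPerm_bruhatLE hΘ.subset hsn (x := ⟨x, hx⟩) (y := ⟨y, hy⟩),
      h.bruhatLE_of_blockPerm (x := ⟨x, hx⟩) (y := ⟨y, hy⟩)⟩
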